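/- Work in type $C_2$ with simple roots $\alpha_1=2\varpi_1-\varpi_2$ (short) and $\alpha_2=-2\varpi_1+2\varpi_2$ (long). Let $\lambda=p\varpi_1+q\varpi_2$ with $p,q\in\mathbb Z_{\ge 0}$, and let $\mathcal B(\lambda)$ be the crystal of Kashiwara--Nakashima (KN) tableaux, in the alphabet $1<2<\bar 2<\bar 1$, whose shape has $q$ columns of height two followed by $p$ columns of height one; the operators $e_i,f_i$ are given by the signature rule on the word of $T$ (columns from right to left, each from top to bottom). For $\{i,j\}=\{1,2\}$ the adapted string of $T\in\mathcal B(\lambda)$ for the reduced word $s_is_js_is_j$ of $w_0$ is $\mathrm{str}_i(T)=(a,b,c,d)$, where $a=\varepsilon_i(T)$, $b=\varepsilon_j(e_i^aT)$, $c=\varepsilon_i(e_j^be_i^aT)$, $d=\varepsilon_j(e_i^ce_j^be_i^aT)$. There is a map $\Phi:\mathcal B(\lambda)\to\mathcal B(\lambda+2\varpi_1)$ with the following properties. 1. $\Phi$ is an embedding of crystals: it is injective, preserves weights, and for $i=1,2$ one has $f_i(\Phi(T))=\Phi(f_i(T))$ whenever $f_i(T)\ne 0$ and $e_i(\Phi(T))=\Phi(e_i(T))$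 whenever $e_i(T)\neq 0$. For $i=2$, moreover, $e_2(T)=0$ implies $e_2(\Phi(T))=0$, and $f_2(T)=0$ implies $f_2(\Phi(T))=0$. 2. $\Phi(T)$ is obtained from $T$ by adding a $1$ at the beginning and a $\bar 1$ at the end of the first row and leaving the second row unchanged, and then replacing the column $(1,\bar 1)$, if it occurs, by the column $(2,\bar 2)$. 3. $\Phi(T)$ is also obtained by inserting the letter $1$ into $T$ by symplectic column insertion and then adding a $\bar 1$ at the end of the first row. 4. For $\{i,j\}=\{1,2\}$ and $\mathrm{str}_i(T)=(a,b,c,d)$ one has $T=f_i^af_j^bf_i^cf_j^d\,v_\lambda$, where $v_\lambda$ is the highest weight vertex of $\mathcal B(\lambda)$. If $\mathrm{str}_1(T)=(a,b,c,d)$, then $\mathrm{str}_1(\Phi(T))=(a+1,b+1,c+1,d)$. If $\mathrm{str}_2(T)=(a,b,c,d)$, then $\mathrm{str}_2(\Phi(T))=(a,b+1,c+1,d+1)$. -/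

import Mathlib

namespace C2

/-- The alphabet `1 < 2 < 2̄ < 1̄`. -/
inductive Letter : Type
  | one
  | two
  | twoBar
  | oneBar
  deriving DecidableEq

namespace Letter

instance : Fintype Letter := ⟨{one, two, twoBar, oneBar}, by intro x; cases x <;> decide⟩

/-- The position of a letter in the alphabet. -/
def rank : Letter → Fin 4
  | one => 0
  | two => 1
  | twoBar => 2
  | oneBar => 3

theorem rank_injective : Function.Injective rank := by decide

instance : LinearOrder Letter := LinearOrder.lift' rank rank_injective

/-- The involution `x ↦ x̄`. -/
def bar : Letter → Letter
  | one => oneBar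
  | two => twoBar
  | twoBar => two
  | oneBar => one

end Letter

/-- The index set `{1, 2}` of the simple roots; `n2` is the long simple root. -/
inductive Node : Type
  | n1
  | n2
  deriving DecidableEq

instance : Fintype Node := ⟨{.n1, .n2}, by intro x; cases x <;> decide⟩

/-- Weights `(a, b)`, standing for `a ϖ₁ + b ϖ₂`. -/
abbrev Weight := ℤ × ℤ

/-- The simple roots `α₁ = 2ϖ₁ - ϖ₂` and `α₂ = -2ϖ₁ + 2ϖ₂`. -/
def simpleRoot : Node → Weight
  | .n1 => (2, -1)
  | .n2 => (-2, 2)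

/-- The pairing of a weight with the simple coroots, `⟨ϖᵢ, αⱼ^∨⟩ = δᵢⱼ`. -/
def corootPairing : Weight → Node → ℤ
  | μ, .n1 => μ.1
  | μ, .n2 => μ.2

/-- Iteration of a partially defined operator; `none` plays the role of `0`. -/
def iter {α : Type*} (g : α → Option α) : ℕ → α → Option α
  | 0, b => some b
  | k + 1, b => (iter g k b).bind g

/-- Seminormal crystals of type `C₂`. The element `0` is `none`. -/
structure Crystal where
  carrier : Type
  nonempty : Nonempty carrier
  wt : carrier → Weight
  e : Node → carrier → Option carrier
  f : Node → carrier → Option carrier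
  eps : Node → carrier → ℕ
  phi : Node → carrier → ℕ
  e_eq_iff : ∀ i b b', e i b = some b' ↔ f i b' = some b
  wt_f : ∀ i b b', f i b = some b' → wt b' = wt b - simpleRoot i
  wt_e : ∀ i b b', e i b = some b' → wt b' = wt b + simpleRoot i
  eps_max : ∀ i b, IsGreatest {a : ℕ | iter (e i) a b ≠ none} (eps i b)
  phi_max : ∀ i b, IsGreatest {a : ℕ | iter (f i) a b ≠ none} (phi i b)
  phi_sub_eps : ∀ i b, (phi i b : ℤ) - (eps i b : ℤ) = corootPairing (wt b) i

/-- An embedding of crystals: an injective weight preserving map that commutes with the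
operators `eᵢ` and `fᵢ` wherever they are defined on the source. -/
structure IsCrystalEmbedding (A B : Crystal) (F : A.carrier → B.carrier) : Prop where
  injective : Function.Injective F
  wt_eq : ∀ b, B.wt (F b) = A.wt b
  map_e : ∀ i b b', A.e i b = some b' → B.e i (F b) = some (F b')
  map_f : ∀ i b b', A.f i b = some b' → B.f i (F b) = some (F b')

namespace Crystal

variable (B : Crystal)

/-- `eᵢ^max b = eᵢ^{εᵢ(b)} b`, which is never `0`. -/
def eMax (i : Node) (b : B.carrier) : B.carrier :=
  (iter (B.e i) (B.eps i b) b).getD b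

/-- The adapted string of `b` for the reduced word `sᵢ sⱼ sᵢ sⱼ` of the longest element. -/
def str (i j : Node) (b : B.carrier) : ℕ × ℕ × ℕ × ℕ :=
  let b₁ := B.eMax i b
  let b₂ := B.eMax j b₁
  let b₃ := B.eMax i b₂
  (B.eps i b, B.eps j b₁, B.eps i b₂, B.eps j b₃)

/-- `fᵢ^a fⱼ^b fᵢ^c fⱼ^d v`, or `none` if this is `0`. -/
def lower (i j : Node) (s : ℕ × ℕ × ℕ × ℕ) (v : B.carrier) : Option B.carrier :=
  (((iter (B.f j) s.2.2.2 v).bind (iter (B.f i) s.2.2.1)).bind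
    (iter (B.f j) s.2.1)).bind (iter (B.f i) s.1)

end Crystal

/-! ### Words and signatures -/

/-- The `i`-label of a letter: `1`, `-1`, `0` stand for `+`, `-`, no label. -/
def label : Node → Letter → SignType
  | .n1, .one => 1
  | .n1, .two => -1
  | .n1, .twoBar => 1
  | .n1, .oneBar => -1
  | .n2, .one => 0
  | .n2, .two => 1
  | .n2, .twoBar => -1
  | .n2, .oneBar => 0

/-- `fᵢ` on a letter with `i`-label `+`: `1 ↦ 2`, `2̄ ↦ 1̄` for `i = 1` and `2 ↦ 2̄` for `i = 2`. -/
def fLetter : Node → Letter → Letter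
  | .n1, .one => .two
  | .n1, .twoBar => .oneBar
  | .n2, .two => .twoBar
  | _, x => x

/-- `eᵢ` on a letter with `i`-label `-`: `2 ↦ 1`, `1̄ ↦ 2̄` for `i = 1` and `2̄ ↦ 2` for `i = 2`. -/
def eLetter : Node → Letter → Letter
  | .n1, .two => .one
  | .n1, .oneBar => .twoBar
  | .n2, .twoBar => .two
  | _, x => x

/-- The `i`-signature `(-)^r (+)^s` of a word, as the pair `(r, s)`: pairs `+ -` are cancelled
like matching brackets. A `+` in front of a word is cancelled exactly if some `-` of that word
survives. -/
def sig (i : Node) : List Letter → ℕ × ℕ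
  | [] => (0, 0)
  | x :: w =>
    match label i x, sig i w with
    | .zero, (r, s) => (r, s)
    | .neg, (r, s) => (r + 1, s)
    | .pos, (0, s) => (0, s + 1)
    | .pos, (r + 1, s) => (r, s)

/-- `fᵢ` on words: change the letter that carries the leftmost surviving `+`. -/
def fWord (i : Node) : List Letter → Option (List Letter)
  | [] => none
  | x :: w =>
    if label i x = 1 ∧ (sig i w).1 = 0 then some (fLetter i x :: w)
    else (fWord i w).map (x :: ·)

/-- `eᵢ` on words: change the letter that carries the rightmost surviving `-`. The surviving `-`
of `x :: w` lie in `w`, unless `x` is labelled `-` and `w` has none, or `x` is labelled `+` and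
cancels the only one of `w`. -/
def eWord (i : Node) : List Letter → Option (List Letter)
  | [] => none
  | x :: w =>
    if label i x = -1 ∧ (sig i w).1 = 0 then some (eLetter i x :: w)
    else if label i x = 1 ∧ (sig i w).1 = 1 then none
    else (eWord i w).map (x :: ·)

/-- The weight of a word: with `tᵢ` the number of `i` minus the number of `ī`, this is
`(t₁ - t₂) ϖ₁ + t₂ ϖ₂`. -/
def wtWord (w : List Letter) : Weight :=
  let t₁ : ℤ := (w.count .one : ℤ) - (w.count .oneBar : ℤ)
  let t₂ : ℤ := (w.count .two : ℤ) - (w.count .twoBar : ℤ)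
  (t₁ - t₂, t₂)

/-! ### Kashiwara-Nakashima tableaux -/

/-- A column of height one or two: its top letter, and its bottom letter if there is one. -/
abbrev Column := Letter × Option Letter

namespace Column

/-- The letters of a column from top to bottom. -/
def letters (C : Column) : List Letter := C.1 :: C.2.toList

/-- Strictly increasing columns. -/
def IsStrict (C : Column) : Prop := ∀ b ∈ C.2, C.1 < b

/-- Admissible columns. A column of height at most two contains at most one pair `z, z̄`. -/
def IsAdmissible (C : Column) : Prop :=
  C.IsStrict ∧ ∀ z ∈ [Letter.one, Letter.two], z ∈ C.letters → z.bar ∈ C.letters →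
    ∃ t ∈ [Letter.one, Letter.two], t < z ∧ t ∉ C.letters ∧ t.bar ∉ C.letters

/-- The split `lC rC` of an admissible column. Only `(2, 2̄)` contains a pair `z, z̄`; there
`z = 2` and `t = 1`. -/
def split (C : Column) : List Column :=
  if C = (.two, some .twoBar) then [(.one, some .twoBar), (.two, some .oneBar)] else [C, C]

end Column

/-- The first row of a list of columns, listed from left to right. -/
def row1 (T : List Column) : List Letter := T.map Prod.fst

/-- The second row of a list of columns, listed from left to right. -/
def row2 (T : List Column) : List Letter := T.filterMap Prod.snd

/-- Columns strictly increasing, rows weakly increasing. -/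
def IsSemistandard (T : List Column) : Prop :=
  (∀ C ∈ T, C.IsStrict) ∧ (row1 T).Pairwise (· ≤ ·) ∧ (row2 T).Pairwise (· ≤ ·)

/-- The list of columns, from left to right, of a KN tableau whose shape is that of
`p ϖ₁ + q ϖ₂`, namely `q` columns of height two followed by `p` columns of height one. -/
structure IsKN (p q : ℕ) (T : List Column) : Prop where
  shape : T.map (fun C => C.letters.length) = List.replicate q 2 ++ List.replicate p 1
  semistandard : IsSemistandard T
  admissible : ∀ C ∈ T, C.IsAdmissible
  split_semistandard : IsSemistandard (T.flatMap Column.split)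

/-- The word of a tableau: columns from right to left, each from top to bottom. -/
def word (T : List Column) : List Letter := T.reverse.flatMap Column.letters

/-- Fills the boxes of a list of columns, in the order of that list, with the letters of a word. -/
def refillAux : List Column → List Letter → List Column
  | (_, none) :: T, x :: w => (x, none) :: refillAux T w
  | (_, some _) :: T, x :: y :: w => (x, some y) :: refillAux T w
  | _, _ => []

/-- The filling of the shape of `T` that has the word `w`. -/
def refill (T : List Column) (w : List Letter) : List Column := (refillAux T.reverse w).reverse

/-- `fᵢ` on tableaux: change in `T` the letter that `fᵢ` changes in the word of `T`. -/
def fTab (i : Node) (T : List Column) : Option (List Column) := (fWord i (word T)).map (refill T)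

/-- `eᵢ` on tableaux: change in `T` the letter that `eᵢ` changes in the word of `T`. -/
def eTab (i : Node) (T : List Column) : Option (List Column) := (eWord i (word T)).map (refill T)

/-! ### The map on tableaux -/

/-- The tableau with the given rows (the second row is not longer than the first). -/
def ofRows : List Letter → List Letter → List Column
  | a :: r, b :: s => (a, some b) :: ofRows r s
  | a :: r, [] => (a, none) :: ofRows r []
  | [], _ => []

/-- Replaces the column `(1, 1̄)` by `(2, 2̄)`. -/
def fixColumn (C : Column) : Column :=
  if C = (.one, some .oneBar) then (.two, some .twoBar) else C

/-- Adds `1` at the beginning and `1̄` at the end of the first row, then replaces a column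
`(1, 1̄)` by `(2, 2̄)`. -/
def embTab (T : List Column) : List Column :=
  (ofRows (.one :: row1 T ++ [.oneBar]) (row2 T)).map fixColumn

/-! ### Symplectic column insertion -/

/-- The result of inserting a letter into a column: the letter is added to the column; or the
column is changed and a letter is bumped into the next column; or the column together with the
letter contracts to at most one letter. -/
inductive InsertResult : Type
  | add (C : Column)
  | bump (C : Column) (y : Letter)
  | contract (y : Option Letter)

/-- Insertion of a letter `x` into an admissible column `C`. Let `w` be the word of `C`.
If `wx` is an admissible column, it is the new column. If `wx` is a column that is not admissible,
the pair `z, z̄` of the contraction relation is deleted from it. If `wx` is not a column, then by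
a plactic relation of length at most three it equals `y w'` with `w'` the word of an admissible
column of the height of `C`; `w'` is the new column and `y` is bumped. -/
def insertColumn (x : Letter) : Column → InsertResult
  | (a, none) =>
    if a < x then
      if a = .one ∧ x = .oneBar then .contract none else .add (a, some x)
    else .bump (x, none) a
  | (a, some b) =>
    if b < x then
      -- `a b x` is a column of height three; it contains exactly one pair `z, z̄`
      if b = a.bar then .contract (some x)
      else if x = a.bar then .contract (some b)
      else .contract (some a)
    else if a = .two ∧ b = .twoBar then
      if .two ≤ x then .bump (.one, some x) .oneBar  -- `2 2̄ x ∼ 1̄ 1 x` for `2 ≤ x ≤ 2̄`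
      else .bump (x, some b) a  -- `a b x ∼ a x b` for `x ≤ a < b`
    else if x ≤ a then
      if x = .one ∧ b = .oneBar then .bump (.two, some .twoBar) a  -- `a 1̄ 1 ∼ a 2 2̄`
      else .bump (x, some b) a  -- `a b x ∼ a x b` for `x ≤ a < b`
    else .bump (a, some x) b  -- `a b x ∼ b a x` for `a < x ≤ b`

/-- Symplectic column insertion of a letter into a tableau, given by its columns from left to
right. -/
def insertTab : Letter → List Column → List Column
  | x, [] => [(x, none)]
  | x, C :: T =>
    match insertColumn x C with
    | .add C' => C' :: T
    | .bump C' y => C' :: insertTab y T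
    | .contract none => T
    | .contract (some y) => insertTab y T

/-- Adds a letter at the end of the first row. -/
def appendRow1 (T : List Column) (x : Letter) : List Column := T ++ [(x, none)]

/-! ### Basic properties of the operators on words -/

theorem label_fLetter (i : Node) (x : Letter) (h : label i x = 1) :
    label i (fLetter i x) = -1 ∧ eLetter i (fLetter i x) = x := by
  revert i x; decide

theorem label_eLetter (i : Node) (x : Letter) (h : label i x = -1) :
    label i (eLetter i x) = 1 ∧ fLetter i (eLetter i x) = x := by
  revert i x; decide

theorem sig_cons_pos {i : Node} {x : Letter} (w : List Letter) (h : label i x = 1) :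
    sig i (x :: w) = if (sig i w).1 = 0 then (0, (sig i w).2 + 1)
      else ((sig i w).1 - 1, (sig i w).2) := by
  have h' : label i x = SignType.pos := h
  rw [sig, h']
  rcases sig i w with ⟨_ | r, s⟩ <;> simp

theorem sig_cons_neg {i : Node} {x : Letter} (w : List Letter) (h : label i x = -1) :
    sig i (x :: w) = ((sig i w).1 + 1, (sig i w).2) := by
  have h' : label i x = SignType.neg := h
  rw [sig, h']

theorem sig_cons_zero {i : Node} {x : Letter} (w : List Letter) (h : label i x = 0) :
    sig i (x :: w) = sig i w := by
  have h' : label i x = SignType.zero := h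
  rw [sig, h']

theorem label_cases (i : Node) (x : Letter) : label i x = 1 ∨ label i x = -1 ∨ label i x = 0 := by
  revert i x; decide

theorem fWord_spec (i : Node) (w : List Letter) :
    ((sig i w).2 = 0 → fWord i w = none) ∧
    ((sig i w).2 ≠ 0 → ∃ w', fWord i w = some w' ∧ eWord i w' = some w ∧
      sig i w' = ((sig i w).1 + 1, (sig i w).2 - 1)) := by
  induction w with
  | nil => simp [sig, fWord]
  | cons x w ih =>
    obtain ⟨ih0, ih1⟩ := ih
    rcases label_cases i x with h | h | h
    · rw [sig_cons_pos w h]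
      by_cases h0 : (sig i w).1 = 0
      · obtain ⟨l1, l2⟩ := label_fLetter i x h
        simp only [h0, if_true]
        refine ⟨by simp, fun _ => ⟨fLetter i x :: w, by simp [fWord, h, h0], ?_, ?_⟩⟩
        · simp [eWord, l1, l2, h0]
        · rw [sig_cons_neg w l1]; simp [h0]
      · simp only [h0, if_false]
        refine ⟨fun h2 => by simp [fWord, h0, ih0 h2], fun h2 => ?_⟩
        obtain ⟨w', a, b, c⟩ := ih1 h2
        refine ⟨x :: w', by simp [fWord, h0, a], ?_, ?_⟩
        · have : label i x ≠ -1 := by rw [h]; decide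
          simp [eWord, this, c, h0, b]
        · rw [sig_cons_pos w' h]; simp [c]; omega
    · rw [sig_cons_neg w h]
      have hn : label i x ≠ 1 := by rw [h]; decide
      refine ⟨fun h2 => by simp [fWord, hn, ih0 h2], fun h2 => ?_⟩
      obtain ⟨w', a, b, c⟩ := ih1 h2
      refine ⟨x :: w', by simp [fWord, hn, a], ?_, ?_⟩
      · simp [eWord, hn, c, b]
      · rw [sig_cons_neg w' h]; simp [c]
    · rw [sig_cons_zero w h]
      have hn : label i x ≠ 1 := by rw [h]; decide
      have hm : label i x ≠ -1 := by rw [h]; decide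
      refine ⟨fun h2 => by simp [fWord, hn, ih0 h2], fun h2 => ?_⟩
      obtain ⟨w', a, b, c⟩ := ih1 h2
      refine ⟨x :: w', by simp [fWord, hn, a], ?_, ?_⟩
      · simp [eWord, hn, hm, b]
      · rw [sig_cons_zero w' h]; exact c

theorem eWord_spec (i : Node) (w : List Letter) :
    ((sig i w).1 = 0 → eWord i w = none) ∧
    ((sig i w).1 ≠ 0 → ∃ w', eWord i w = some w' ∧ fWord i w' = some w ∧
      sig i w' = ((sig i w).1 - 1, (sig i w).2 + 1)) := by
  induction w with
  | nil => simp [sig, eWord]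
  | cons x w ih =>
    obtain ⟨ih0, ih1⟩ := ih
    rcases label_cases i x with h | h | h
    · rw [sig_cons_pos w h]
      have hm : label i x ≠ -1 := by rw [h]; decide
      by_cases h0 : (sig i w).1 = 0
      · simp [h0, eWord, hm, ih0 h0]
      · simp only [h0, if_false]
        refine ⟨fun h2 => ?_, fun h2 => ?_⟩
        · have : (sig i w).1 = 1 := by omega
          simp [eWord, h, this]
        · obtain ⟨w', a, b, c⟩ := ih1 h0
          have h1 : (sig i w).1 ≠ 1 := by omega
          refine ⟨x :: w', by simp [eWord, hm, h1, a], ?_, ?_⟩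
          · have : (sig i w').1 ≠ 0 := by rw [c]; exact h2
            simp [fWord, this, b]
          · rw [sig_cons_pos w' h]
            have : (sig i w).1 - 1 ≠ 0 := h2
            simp [c, this]
    · rw [sig_cons_neg w h]
      have hn : label i x ≠ 1 := by rw [h]; decide
      refine ⟨by simp, fun _ => ?_⟩
      by_cases h0 : (sig i w).1 = 0
      · obtain ⟨l1, l2⟩ := label_eLetter i x h
        refine ⟨eLetter i x :: w, by simp [eWord, h, h0], ?_, ?_⟩
        · simp [fWord, l1, l2, h0]
        · rw [sig_cons_pos w l1]; simp [h0]
      · obtain ⟨w', a, b, c⟩ := ih1 h0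
        refine ⟨x :: w', by simp [eWord, hn, h0, a], by simp [fWord, hn, b], ?_⟩
        rw [sig_cons_neg w' h]; simp [c]; omega
    · rw [sig_cons_zero w h]
      have hn : label i x ≠ 1 := by rw [h]; decide
      have hm : label i x ≠ -1 := by rw [h]; decide
      refine ⟨fun h2 => by simp [eWord, hn, hm, ih0 h2], fun h2 => ?_⟩
      obtain ⟨w', a, b, c⟩ := ih1 h2
      refine ⟨x :: w', by simp [eWord, hn, hm, a], by simp [fWord, hn, b], ?_⟩
      rw [sig_cons_zero w' h]; exact c

theorem fWord_sig {i : Node} {w w' : List Letter} (h : fWord i w = some w') :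
    (sig i w).2 ≠ 0 ∧ eWord i w' = some w ∧ sig i w' = ((sig i w).1 + 1, (sig i w).2 - 1) := by
  by_cases h0 : (sig i w).2 = 0
  · rw [(fWord_spec i w).1 h0] at h; simp at h
  · obtain ⟨v, a, b⟩ := (fWord_spec i w).2 h0
    rw [h] at a; cases a; exact ⟨h0, b⟩

theorem eWord_sig {i : Node} {w w' : List Letter} (h : eWord i w = some w') :
    (sig i w).1 ≠ 0 ∧ fWord i w' = some w ∧ sig i w' = ((sig i w).1 - 1, (sig i w).2 + 1) := by
  by_cases h0 : (sig i w).1 = 0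
  · rw [(eWord_spec i w).1 h0] at h; simp at h
  · obtain ⟨v, a, b⟩ := (eWord_spec i w).2 h0
    rw [h] at a; cases a; exact ⟨h0, b⟩

theorem wtWord_cons (x : Letter) (w : List Letter) :
    wtWord (x :: w) = wtWord [x] + wtWord w := by
  cases x <;> simp [wtWord] <;> ring_nf <;> trivial

theorem wtWord_fLetter (i : Node) (x : Letter) (h : label i x = 1) :
    wtWord [fLetter i x] = wtWord [x] - simpleRoot i := by
  revert i x; decide

theorem fWord_wt_length {i : Node} {w w' : List Letter} (h : fWord i w = some w') :
    wtWord w' = wtWord w - simpleRoot i ∧ w'.length = w.length := by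
  induction w generalizing w' with
  | nil => simp [fWord] at h
  | cons x w ih =>
    rw [fWord] at h
    split_ifs at h with hc
    · cases h
      rw [wtWord_cons, wtWord_fLetter i x hc.1, wtWord_cons x w]
      exact ⟨by abel, rfl⟩
    · obtain ⟨v, hv, rfl⟩ := Option.map_eq_some_iff.1 h
      obtain ⟨a, b⟩ := ih hv
      rw [wtWord_cons, a, wtWord_cons x w]
      exact ⟨by abel, by simp [b]⟩

theorem sig_wt (i : Node) (w : List Letter) :
    ((sig i w).2 : ℤ) - ((sig i w).1 : ℤ) = corootPairing (wtWord w) i := by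
  induction w with
  | nil => cases i <;> simp [sig, wtWord, corootPairing]
  | cons x w ih =>
    have key : corootPairing (wtWord (x :: w)) i
        = corootPairing (wtWord [x]) i + corootPairing (wtWord w) i := by
      rw [wtWord_cons]; cases i <;> simp [corootPairing]
    have key2 : corootPairing (wtWord [x]) i = (label i x : ℤ) := by
      clear * -; revert i x; decide
    rw [key, key2, ← ih]
    rcases label_cases i x with h | h | h
    · rw [sig_cons_pos w h, h]; split_ifs with h0
      · simp [h0]; ring
      · simp; omega
    · rw [sig_cons_neg w h, h]; simp; ring
    · rw [sig_cons_zero w h, h]; simp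

theorem sig_append (i : Node) (u v : List Letter) :
    sig i (u ++ v) = ((sig i u).1 + ((sig i v).1 - (sig i u).2),
      (sig i v).2 + ((sig i u).2 - (sig i v).1)) := by
  induction u with
  | nil => simp [sig]
  | cons x u ih =>
    rw [List.cons_append]
    rcases label_cases i x with h | h | h
    · rw [sig_cons_pos _ h, sig_cons_pos _ h, ih]
      by_cases h0 : (sig i u).1 = 0
      · by_cases h1 : (sig i v).1 - (sig i u).2 = 0
        · simp [h0, h1]; omega
        · simp [h0, h1]; omega
      · simp [h0]; omega
    · rw [sig_cons_neg _ h, sig_cons_neg _ h, ih]; simp; omega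
    · rw [sig_cons_zero _ h, sig_cons_zero _ h, ih]

theorem fWord_append (i : Node) (u v : List Letter) :
    fWord i (u ++ v) = if (sig i v).1 < (sig i u).2 then (fWord i u).map (· ++ v)
      else (fWord i v).map (u ++ ·) := by
  induction u with
  | nil => simp [sig]
  | cons x u ih =>
    rw [List.cons_append, fWord, fWord, ih]
    rcases label_cases i x with h | h | h
    · rw [sig_cons_pos _ h, sig_append]
      by_cases h0 : (sig i u).1 = 0
      · by_cases h1 : (sig i v).1 ≤ (sig i u).2
        · have h2 : (sig i v).1 - (sig i u).2 = 0 := by omega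
          simp [h, h0, h2]; omega
        · have h2 : ¬ ((sig i v).1 - (sig i u).2 = 0) := by omega
          have h3 : ¬ ((sig i v).1 < (sig i u).2) := by omega
          simp only [h, h0, h3, if_false]
          simp [Function.comp_def]
          rw [if_neg (by omega), if_neg h1]
      · simp only [h, h0]
        split_ifs <;> simp_all [Function.comp_def]
    · have hn : label i x ≠ 1 := by rw [h]; decide
      rw [sig_cons_neg _ h]
      simp only [hn, false_and, if_false]
      split_ifs <;> simp [Function.comp_def]
    · have hn : label i x ≠ 1 := by rw [h]; decide
      rw [sig_cons_zero _ h]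
      simp only [hn, false_and, if_false]
      split_ifs <;> simp [Function.comp_def]

/-! ### The operators preserve tableaux -/

theorem word_cons (C : Column) (T : List Column) : word (C :: T) = word T ++ C.letters := by
  simp [word]

/-- The number of boxes of a list of columns. -/
def size (T : List Column) : ℕ := (T.flatMap Column.letters).length

theorem size_cons (C : Column) (T : List Column) : size (C :: T) = C.letters.length + size T := by
  simp [size]

theorem length_word (T : List Column) : (word T).length = size T := by
  induction T with
  | nil => rfl
  | cons C T ih => rw [word_cons, List.length_append, ih, size_cons, add_comm]

theorem size_reverse (T : List Column) : size T.reverse = size T := by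
  rw [← length_word T]; rfl

theorem refillAux_append (A B : List Column) (u v : List Letter) (h : u.length = size A) :
    refillAux (A ++ B) (u ++ v) = refillAux A u ++ refillAux B v := by
  induction A generalizing u with
  | nil => simp [size] at h; subst h; simp [refillAux]
  | cons C A ih =>
    rw [size_cons] at h
    obtain ⟨a, _ | b⟩ := C
    · rcases u with _ | ⟨x, u⟩
      · simp [Column.letters] at h; omega
      · simp only [Column.letters, List.length_cons, Option.toList, List.length_nil] at h
        simp [refillAux, ih u (by omega)]
    · rcases u with _ | ⟨x, _ | ⟨y, u⟩⟩
      · simp [Column.letters] at h; omega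
      · simp [Column.letters] at h; omega
      · simp only [Column.letters, List.length_cons, Option.toList, List.length_nil] at h
        simp [refillAux, ih u (by omega)]

theorem refillAux_spec (A : List Column) (u : List Letter) (h : u.length = size A) :
    (refillAux A u).flatMap Column.letters = u ∧
    (refillAux A u).map (fun C => C.letters.length) = A.map (fun C => C.letters.length) := by
  induction A generalizing u with
  | nil => simp [size] at h; subst h; simp [refillAux]
  | cons C A ih =>
    rw [size_cons] at h
    obtain ⟨a, _ | b⟩ := C
    · rcases u with _ | ⟨x, u⟩
      · simp [Column.letters] at h; omega
      · simp only [Column.letters, List.length_cons, Option.toList, List.length_nil] at h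
        obtain ⟨p, q⟩ := ih u (by omega)
        exact ⟨by simp [refillAux, p, Column.letters],
          by rw [refillAux, List.map_cons, q]; rfl⟩
    · rcases u with _ | ⟨x, _ | ⟨y, u⟩⟩
      · simp [Column.letters] at h; omega
      · simp [Column.letters] at h; omega
      · simp only [Column.letters, List.length_cons, Option.toList, List.length_nil] at h
        obtain ⟨p, q⟩ := ih u (by omega)
        exact ⟨by simp [refillAux, p, Column.letters],
          by rw [refillAux, List.map_cons, q]; rfl⟩

/-- A list of columns is determined by its shape and its word. -/
theorem eq_of_letters (A B : List Column)
    (h : A.map (fun C => C.letters.length) = B.map (fun C => C.letters.length))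
    (h' : A.flatMap Column.letters = B.flatMap Column.letters) : A = B := by
  induction A generalizing B with
  | nil => cases B with
    | nil => rfl
    | cons => simp at h
  | cons C A ih =>
    cases B with
    | nil => simp at h
    | cons D B =>
      simp only [List.map_cons, List.cons.injEq] at h
      simp only [List.flatMap_cons] at h'
      obtain ⟨p, q⟩ := List.append_inj h' h.1
      have hCD : C = D := by
        obtain ⟨a, _ | b⟩ := C <;> obtain ⟨c, _ | d⟩ := D <;> simp_all [Column.letters]
      rw [hCD, ih B h.2 q]

theorem eq_of_word (A B : List Column)
    (h : A.map (fun C => C.letters.length) = B.map (fun C => C.letters.length))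
    (h' : word A = word B) : A = B := by
  apply List.reverse_injective
  apply eq_of_letters _ _ _ h'
  rw [List.map_reverse, List.map_reverse, h]

theorem refill_spec (T : List Column) (w : List Letter) (h : w.length = size T) :
    word (refill T w) = w ∧
    (refill T w).map (fun C => C.letters.length) = T.map (fun C => C.letters.length) := by
  obtain ⟨p, q⟩ := refillAux_spec T.reverse w (by rw [h, size_reverse])
  refine ⟨by simpa [word, refill] using p, ?_⟩
  rw [refill, List.map_reverse, q, List.map_reverse, List.reverse_reverse]

theorem eWord_wt_length {i : Node} {w w' : List Letter} (h : eWord i w = some w') :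
    wtWord w' = wtWord w + simpleRoot i ∧ w'.length = w.length := by
  obtain ⟨a, b⟩ := fWord_wt_length (eWord_sig h).2.1
  exact ⟨by rw [a]; abel, b.symm⟩

theorem fTab_iff (i : Node) (T U : List Column) :
    fTab i T = some U ↔ fWord i (word T) = some (word U) ∧
      U.map (fun C => C.letters.length) = T.map (fun C => C.letters.length) := by
  rw [fTab, Option.map_eq_some_iff]
  constructor
  · rintro ⟨w, hw, rfl⟩
    obtain ⟨p, q⟩ := refill_spec T w (by rw [(fWord_wt_length hw).2, length_word])
    exact ⟨by rw [p, hw], q⟩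
  · rintro ⟨h1, h2⟩
    refine ⟨_, h1, ?_⟩
    obtain ⟨p, q⟩ := refill_spec T (word U) (by rw [(fWord_wt_length h1).2, length_word])
    exact eq_of_word _ _ (q.trans h2.symm) p

theorem eTab_iff (i : Node) (T U : List Column) :
    eTab i T = some U ↔ eWord i (word T) = some (word U) ∧
      U.map (fun C => C.letters.length) = T.map (fun C => C.letters.length) := by
  rw [eTab, Option.map_eq_some_iff]
  constructor
  · rintro ⟨w, hw, rfl⟩
    obtain ⟨p, q⟩ := refill_spec T w (by rw [(eWord_wt_length hw).2, length_word])
    exact ⟨by rw [p, hw], q⟩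
  · rintro ⟨h1, h2⟩
    refine ⟨_, h1, ?_⟩
    obtain ⟨p, q⟩ := refill_spec T (word U) (by rw [(eWord_wt_length h1).2, length_word])
    exact eq_of_word _ _ (q.trans h2.symm) p

theorem eTab_iff_fTab (i : Node) (T U : List Column) :
    eTab i T = some U ↔ fTab i U = some T := by
  rw [eTab_iff, fTab_iff]
  constructor
  · rintro ⟨a, b⟩; exact ⟨(eWord_sig a).2.1, b.symm⟩
  · rintro ⟨a, b⟩; exact ⟨(fWord_sig a).2.1, b.symm⟩

theorem fTab_cons (i : Node) (C : Column) (T U : List Column) (h : fTab i (C :: T) = some U) :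
    (∃ T', U = C :: T' ∧ (sig i C.letters).1 < (sig i (word T)).2 ∧ fTab i T = some T') ∨
    (∃ C', U = C' :: T ∧ (sig i (word T)).2 ≤ (sig i C.letters).1 ∧ fTab i [C] = some [C']) := by
  obtain ⟨h1, h2⟩ := (fTab_iff _ _ _).1 h
  cases U with
  | nil => simp at h2
  | cons D U =>
    simp only [List.map_cons, List.cons.injEq] at h2
    rw [word_cons, word_cons, fWord_append] at h1
    split_ifs at h1 with hc
    · left
      obtain ⟨w, hw, hw'⟩ := Option.map_eq_some_iff.1 h1
      obtain ⟨p, q⟩ := List.append_inj' hw' h2.1.symm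
      have : C = D := by
        have := eq_of_letters [C] [D] (by simp [h2.1]) (by simp [q])
        simpa using this
      subst this
      exact ⟨U, rfl, hc, (fTab_iff _ _ _).2 ⟨by rw [hw, p], h2.2⟩⟩
    · right
      obtain ⟨w, hw, hw'⟩ := Option.map_eq_some_iff.1 h1
      obtain ⟨p, q⟩ := List.append_inj' hw' (by rw [(fWord_wt_length hw).2, h2.1])
      have hU : T = U := eq_of_word _ _ h2.2.symm p
      subst hU
      refine ⟨D, rfl, by omega, (fTab_iff _ _ _).2 ⟨?_, by simp [h2.1]⟩⟩
      simp only [word, List.reverse_singleton, List.flatMap_singleton]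
      rw [hw, q]

instance (C : Column) : Decidable C.IsStrict := by unfold Column.IsStrict; infer_instance

instance (C : Column) : Decidable C.IsAdmissible := by
  unfold Column.IsAdmissible; infer_instance

instance (T : List Column) : Decidable (IsSemistandard T) := by
  unfold IsSemistandard; infer_instance

/-- Two admissible columns that may stand side by side in a KN tableau. -/
def Adjacent (C D : Column) : Prop :=
  C.IsAdmissible ∧ D.IsAdmissible ∧ D.letters.length ≤ C.letters.length ∧
    IsSemistandard [C, D] ∧ IsSemistandard (C.split ++ D.split)

instance (C D : Column) : Decidable (Adjacent C D) := by unfold Adjacent; infer_instance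

/-- The admissible columns. -/
def admissibleColumns : List Column :=
  [(.one, none), (.two, none), (.twoBar, none), (.oneBar, none), (.one, some .two),
    (.one, some .twoBar), (.two, some .twoBar), (.two, some .oneBar), (.twoBar, some .oneBar)]

theorem mem_admissibleColumns (C : Column) : C.IsAdmissible ↔ C ∈ admissibleColumns := by
  revert C; decide

theorem adjacent_trans_aux : ∀ C ∈ admissibleColumns, ∀ D ∈ admissibleColumns, Adjacent C D →
    ∀ E ∈ admissibleColumns, Adjacent D E → Adjacent C E := by
  decide +kernel

instance : IsTrans Column Adjacent :=
  ⟨fun C D E h h' => adjacent_trans_aux C ((mem_admissibleColumns C).1 h.1)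
    D ((mem_admissibleColumns D).1 h.2.1) h E ((mem_admissibleColumns E).1 h'.2.1) h'⟩


theorem adjacent_f_right : ∀ (i : Node) (D D' : Column), fTab i [D] = some [D'] →
    ∀ C : Column, (sig i C.letters).1 < (sig i D.letters).2 →
      (Adjacent C D ↔ Adjacent C D') := by
  decide +kernel

theorem adjacent_f_left : ∀ (i : Node) (C C' : Column), fTab i [C] = some [C'] →
    ∀ D : Column, (sig i D.letters).2 ≤ (sig i C.letters).1 →
      (Adjacent C D ↔ Adjacent C' D) := by
  decide +kernel

theorem admissible_f : ∀ (i : Node) (C C' : Column), fTab i [C] = some [C'] →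
    (C.IsAdmissible ↔ C'.IsAdmissible) := by
  decide +kernel

theorem sig_word_cons (i : Node) (C : Column) (T : List Column) :
    (sig i (word (C :: T))).2 =
      (sig i C.letters).2 + ((sig i (word T)).2 - (sig i C.letters).1) := by
  rw [word_cons, sig_append]

theorem fTab_nil (i : Node) (U : List Column) : fTab i [] ≠ some U := by
  simp [fTab, word, fWord]

theorem admissible_fTab (i : Node) (T U : List Column) (h : fTab i T = some U) :
    (∀ C ∈ T, C.IsAdmissible) ↔ ∀ C ∈ U, C.IsAdmissible := by
  induction T generalizing U with
  | nil => exact absurd h (fTab_nil i U)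
  | cons C T ih =>
    rcases fTab_cons i C T U h with ⟨T', rfl, -, h'⟩ | ⟨C', rfl, -, h'⟩
    · simp only [List.forall_mem_cons, ih T' h']
    · simp only [List.forall_mem_cons, admissible_f i C C' h']

theorem isChain_fTab (i : Node) (T U : List Column) (h : fTab i T = some U) :
    T.IsChain Adjacent ↔ U.IsChain Adjacent := by
  induction T generalizing U with
  | nil => exact absurd h (fTab_nil i U)
  | cons C T ih =>
    rcases fTab_cons i C T U h with ⟨T', rfl, hc, h'⟩ | ⟨C', rfl, hc, h'⟩
    · cases T with
      | nil => exact absurd h' (fTab_nil i T')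
      | cons D T =>
        have ih' := ih T' h'
        rcases fTab_cons i D T T' h' with ⟨T'', rfl, -, -⟩ | ⟨D', rfl, hd, hD⟩
        · rw [List.isChain_cons_cons, List.isChain_cons_cons, ih']
        · rw [sig_word_cons] at hc
          rw [List.isChain_cons_cons, List.isChain_cons_cons, ih',
            adjacent_f_right i D D' hD C (by omega)]
    · cases T with
      | nil => simp
      | cons D T =>
        rw [sig_word_cons] at hc
        rw [List.isChain_cons_cons, List.isChain_cons_cons,
          adjacent_f_left i C C' h' D (by omega)]

/-- Rows of two columns in a semistandard tableau. -/
def RowLE (C D : Column) : Prop := C.1 ≤ D.1 ∧ ∀ b ∈ C.2, ∀ d ∈ D.2, b ≤ d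

theorem isSemistandard_iff (T : List Column) :
    IsSemistandard T ↔ (∀ C ∈ T, C.IsStrict) ∧ T.Pairwise RowLE := by
  unfold IsSemistandard row1 row2 RowLE
  rw [List.pairwise_map, List.pairwise_filterMap, List.pairwise_and_iff]
  rfl

theorem isSemistandard_split (C : Column) (h : C.IsAdmissible) : IsSemistandard C.split := by
  revert C; decide

theorem isKN_iff (p q : ℕ) (T : List Column) : IsKN p q T ↔
    T.map (fun C => C.letters.length) = List.replicate q 2 ++ List.replicate p 1 ∧
    (∀ C ∈ T, C.IsAdmissible) ∧ T.IsChain Adjacent := by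
  rw [List.isChain_iff_pairwise]
  constructor
  · rintro ⟨h1, h2, h3, h4⟩
    refine ⟨h1, h3, ?_⟩
    have hs : (T.map (fun C => C.letters.length)).Pairwise (fun a b => b ≤ a) := by
      rw [h1, List.pairwise_append]
      refine ⟨by simp [List.pairwise_replicate], by simp [List.pairwise_replicate], ?_⟩
      intro a ha b hb
      rw [List.eq_of_mem_replicate ha, List.eq_of_mem_replicate hb]; decide
    rw [List.pairwise_map] at hs
    rw [isSemistandard_iff] at h2 h4
    obtain ⟨h4a, h4b⟩ := h4
    rw [List.pairwise_flatMap] at h4b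
    refine (hs.and (h2.2.and h4b.2)).imp_of_mem ?_
    rintro C D hC hD ⟨hl, hr, hsp⟩
    refine ⟨h3 C hC, h3 D hD, hl, ?_, ?_⟩
    · rw [isSemistandard_iff]
      exact ⟨by simpa using ⟨(h3 C hC).1, (h3 D hD).1⟩, by simpa using hr⟩
    · have sC := (isSemistandard_iff _).1 (isSemistandard_split C (h3 C hC))
      have sD := (isSemistandard_iff _).1 (isSemistandard_split D (h3 D hD))
      rw [isSemistandard_iff, List.pairwise_append]
      refine ⟨fun E hE => ?_, sC.2, sD.2, hsp⟩
      rcases List.mem_append.1 hE with h | h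
      · exact sC.1 E h
      · exact sD.1 E h
  · rintro ⟨h1, h3, h⟩
    refine ⟨h1, ?_, h3, ?_⟩
    · rw [isSemistandard_iff]
      refine ⟨fun C hC => (h3 C hC).1, h.imp ?_⟩
      rintro C D ⟨-, -, -, h, -⟩
      rw [isSemistandard_iff] at h
      simpa using h.2
    · rw [isSemistandard_iff]
      refine ⟨?_, ?_⟩
      · intro D hD
        obtain ⟨C, hC, hD⟩ := List.mem_flatMap.1 hD
        exact (isSemistandard_split C (h3 C hC)).1 D hD
      · rw [List.pairwise_flatMap]
        refine ⟨fun C hC => ((isSemistandard_iff _).1 (isSemistandard_split C (h3 C hC))).2,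
          h.imp ?_⟩
        rintro C D ⟨-, -, -, -, h⟩
        rw [isSemistandard_iff, List.pairwise_append] at h
        exact h.2.2.2

theorem isKN_fTab (p q : ℕ) (i : Node) (T U : List Column) (h : fTab i T = some U) :
    IsKN p q T ↔ IsKN p q U := by
  rw [isKN_iff, isKN_iff, admissible_fTab i T U h, isChain_fTab i T U h, ((fTab_iff _ _ _).1 h).2]

theorem isGreatest_iter {α : Type*} (g : α → Option α) (n : α → ℕ)
    (h0 : ∀ b, n b = 0 → g b = none)
    (h1 : ∀ b, n b ≠ 0 → ∃ b', g b = some b' ∧ n b' = n b - 1) (b : α) :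
    IsGreatest {a : ℕ | iter g a b ≠ none} (n b) := by
  have key : ∀ a, a ≤ n b → ∃ b', iter g a b = some b' ∧ n b' = n b - a := by
    intro a
    induction a with
    | zero => exact fun _ => ⟨b, rfl, rfl⟩
    | succ a ih =>
      intro ha
      obtain ⟨c, hc, hn⟩ := ih (by omega)
      obtain ⟨d, hd, hm⟩ := h1 c (by omega)
      exact ⟨d, by rw [iter, hc, Option.bind_some, hd], by omega⟩
  have key2 : ∀ k, iter g (n b + 1 + k) b = none := by
    intro k
    induction k with
    | zero =>
      obtain ⟨c, hc, hn⟩ := key (n b) le_rfl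
      rw [Nat.add_zero, iter, hc, Option.bind_some, h0 c (by omega)]
    | succ k ih => rw [← Nat.add_assoc, iter, ih, Option.bind_none]
  refine ⟨?_, fun a ha => ?_⟩
  · obtain ⟨c, hc, -⟩ := key (n b) le_rfl
    simp [hc]
  · by_contra hlt
    obtain ⟨k, rfl⟩ := Nat.exists_eq_add_of_le (show n b + 1 ≤ a by omega)
    exact ha (key2 k)

/-- The columns of the highest weight tableau: `1` in the first row, `2` in the second. -/
def highestColumns (p q : ℕ) : List Column :=
  List.replicate q (.one, some .two) ++ List.replicate p (.one, none)

theorem isKN_highestColumns (p q : ℕ) : IsKN p q (highestColumns p q) := by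
  rw [isKN_iff, List.isChain_iff_pairwise]
  refine ⟨by simp [highestColumns, Column.letters], ?_, ?_⟩
  · intro C hC
    rcases List.mem_append.1 hC with h | h <;> rw [List.eq_of_mem_replicate h] <;> decide
  · rw [highestColumns, List.pairwise_append]
    refine ⟨List.pairwise_replicate.2 (Or.inr (by decide)),
      List.pairwise_replicate.2 (Or.inr (by decide)), ?_⟩
    intro a ha b hb
    rw [List.eq_of_mem_replicate ha, List.eq_of_mem_replicate hb]; decide

/-! ### The crystal `B(λ)` -/

/-- KN tableaux of the shape of `p ϖ₁ + q ϖ₂`. -/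
abbrev KN (p q : ℕ) : Type := {T : List Column // IsKN p q T}

namespace KN

variable {p q : ℕ}

/-- `fᵢ` on KN tableaux. -/
def f (i : Node) (T : KN p q) : Option (KN p q) :=
  (fTab i T.1).pmap Subtype.mk fun U hU => (isKN_fTab p q i T.1 U hU).1 T.2

/-- `eᵢ` on KN tableaux. -/
def e (i : Node) (T : KN p q) : Option (KN p q) :=
  (eTab i T.1).pmap Subtype.mk fun U hU =>
    (isKN_fTab p q i U T.1 ((eTab_iff_fTab i T.1 U).1 hU)).2 T.2

theorem f_eq_some (i : Node) (T U : KN p q) : f i T = some U ↔ fTab i T.1 = some U.1 := by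
  rw [f, Option.pmap_eq_some_iff]
  constructor
  · rintro ⟨V, h, hV, rfl⟩; exact hV
  · intro h; exact ⟨U.1, U.2, h, rfl⟩

theorem e_eq_some (i : Node) (T U : KN p q) : e i T = some U ↔ eTab i T.1 = some U.1 := by
  rw [e, Option.pmap_eq_some_iff]
  constructor
  · rintro ⟨V, h, hV, rfl⟩; exact hV
  · intro h; exact ⟨U.1, U.2, h, rfl⟩

theorem e_eq_iff (i : Node) (T U : KN p q) : e i T = some U ↔ f i U = some T := by
  rw [e_eq_some, f_eq_some, eTab_iff_fTab]

theorem f_sig {i : Node} {T U : KN p q} (h : f i T = some U) :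
    (sig i (word T.1)).2 ≠ 0 ∧
    sig i (word U.1) = ((sig i (word T.1)).1 + 1, (sig i (word T.1)).2 - 1) := by
  have h' := fWord_sig ((fTab_iff _ _ _).1 ((f_eq_some i T U).1 h)).1
  exact ⟨h'.1, h'.2.2⟩

theorem f_ne_none {i : Node} {T : KN p q} (h : (sig i (word T.1)).2 ≠ 0) :
    ∃ U, f i T = some U := by
  obtain ⟨w, hw, -⟩ := (fWord_spec i (word T.1)).2 h
  have : fTab i T.1 = some (refill T.1 w) := by rw [fTab, hw]; rfl
  exact ⟨⟨_, (isKN_fTab p q i _ _ this).1 T.2⟩, (f_eq_some _ _ _).2 this⟩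

theorem e_ne_none {i : Node} {T : KN p q} (h : (sig i (word T.1)).1 ≠ 0) :
    ∃ U, e i T = some U := by
  obtain ⟨w, hw, -⟩ := (eWord_spec i (word T.1)).2 h
  have : eTab i T.1 = some (refill T.1 w) := by rw [eTab, hw]; rfl
  exact ⟨⟨_, (isKN_fTab p q i _ _ ((eTab_iff_fTab _ _ _).1 this)).2 T.2⟩, (e_eq_some _ _ _).2 this⟩

/-- The highest weight vertex. -/
def highest (p q : ℕ) : KN p q := ⟨highestColumns p q, isKN_highestColumns p q⟩

theorem wt_f (i : Node) (T U : KN p q) (h : f i T = some U) :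
    wtWord (word U.1) = wtWord (word T.1) - simpleRoot i :=
  (fWord_wt_length ((fTab_iff _ _ _).1 ((f_eq_some i T U).1 h)).1).1

end KN

/-- The crystal `B(p ϖ₁ + q ϖ₂)`, realized by KN tableaux. -/
def crystal (p q : ℕ) : Crystal where
  carrier := KN p q
  nonempty := ⟨KN.highest p q⟩
  wt T := wtWord (word T.1)
  e := KN.e
  f := KN.f
  eps i T := (sig i (word T.1)).1
  phi i T := (sig i (word T.1)).2
  e_eq_iff := KN.e_eq_iff
  wt_f := KN.wt_f
  wt_e i T U h := by rw [KN.wt_f i U T ((KN.e_eq_iff i T U).1 h)]; abel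
  eps_max i T := by
    refine isGreatest_iter (KN.e i) (fun T => (sig i (word T.1)).1) (fun b hb => ?_)
      (fun b hb => ?_) T
    · rcases h : KN.e i b with _ | U
      · rfl
      · have := KN.f_sig ((KN.e_eq_iff _ _ _).1 h)
        rw [this.2] at hb; simp at hb
    · obtain ⟨U, hU⟩ := KN.e_ne_none hb
      have := KN.f_sig ((KN.e_eq_iff _ _ _).1 hU)
      exact ⟨U, hU, by rw [this.2]; simp⟩
  phi_max i T := by
    refine isGreatest_iter (KN.f i) (fun T => (sig i (word T.1)).2) (fun b hb => ?_)
      (fun b hb => ?_) T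
    · rcases h : KN.f i b with _ | U
      · rfl
      · exact absurd hb (KN.f_sig h).1
    · obtain ⟨U, hU⟩ := KN.f_ne_none hb
      exact ⟨U, hU, by rw [(KN.f_sig hU).2]⟩
  phi_sub_eps i T := sig_wt i (word T.1)

end C2

namespace C2

/-! ### Crystal equivalence of words -/

/-! Let `w` be the word of `T`. The image of `T` is the tableau whose word occupies the same place
in its crystal as the framed word `1̄ w 1`. This gives the tableau description and the crystal
properties together.

Tableau side: a letter inserted into a column that may stand to its right in a KN tableau, coming
from the top of its left neighbour, always bumps the top letter. Inserting `1` therefore moves the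
first row one box to the right, and only the column `(1, 1̄)` must be rewritten as `(2, 2̄)`. Each
bump replaces a factor of the word by a crystal equivalent one (`bumpPairs`, a finite check), and
equivalence is a congruence, so `w 1` is equivalent to the word of the new tableau
(`word_shiftTab`). Appending `1̄` to the first row puts `1̄` in front of the word; this is
`KN.word_extend`.

Crystal side: by the signature rule the front letter `1̄` carries no `+` and the last letter `1` no
`-`. So `f` and `e` act inside `w` as long as they do not kill it, and for the index `2` the frame
is invisible. The maximal power of `e` exhausts `w` first and only then moves the front letter,
which runs through `1̄, 2̄, 2, 1`. Each move adds one to an entry of the string, whence the two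
shift patterns (`eMaxWord_frame`).

To turn equivalence of words into equality of tableaux one needs that a string determines its
tableau. This follows once four maximal raisings reach the highest weight vertex: after each one,
fewer kinds of columns can occur (`forall_mem_of_eps_eq_zero`, `eMax_string_one`,
`eMax_string_two`). Strings are invariant under equivalence, so `KN.eq_of_crystalEquiv` follows;
injectivity holds because the shift of strings is injective. -/

theorem eWord_append (i : Node) (u v : List Letter) :
    eWord i (u ++ v) = if (sig i u).2 < (sig i v).1 then (eWord i v).map (u ++ ·)
      else (eWord i u).map (· ++ v) := by
  induction u with
  | nil =>
    by_cases h : (sig i v).1 = 0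
    · simp [sig, h, (eWord_spec i v).1 h, eWord]
    · simp [sig, Nat.pos_of_ne_zero h]
  | cons x u ih =>
    rw [List.cons_append, eWord, eWord, ih, sig_append]
    rcases label_cases i x with h | h | h
    · rw [sig_cons_pos _ h]
      simp only [h, show (1 : SignType) ≠ -1 by decide, false_and, if_false, true_and]
      by_cases h0 : (sig i u).1 = 0
      · simp only [h0, (eWord_spec i u).1 h0]
        split_ifs <;> first | omega | simp [Function.comp_def]
      · simp only [h0, if_false]
        split_ifs <;> first | omega | simp [Function.comp_def]
    · rw [sig_cons_neg _ h]
      simp only [h, show (-1 : SignType) ≠ 1 by decide, false_and, if_false, true_and]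
      split_ifs <;> first | omega | simp [Function.comp_def]
    · rw [sig_cons_zero _ h]
      simp only [h, show (0 : SignType) ≠ 1 by decide, show (0 : SignType) ≠ -1 by decide,
        false_and, if_false]
      split_ifs <;> simp [Function.comp_def]

/-- A relation between words that respects signatures and the operators `eᵢ` and `fᵢ`. -/
structure IsBisimulation (R : List Letter → List Letter → Prop) : Prop where
  sig_eq : ∀ {u v}, R u v → ∀ i, sig i u = sig i v
  f : ∀ {u v}, R u v → ∀ {i u'}, fWord i u = some u' → ∃ v', fWord i v = some v' ∧ R u' v'
  e : ∀ {u v}, R u v → ∀ {i u'}, eWord i u = some u' → ∃ v', eWord i v = some v' ∧ R u' v'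

/-- Two words are crystal equivalent if they occupy the same place in isomorphic crystals. -/
def CrystalEquiv (u v : List Letter) : Prop := ∃ R, IsBisimulation R ∧ R u v

/-- Coinduction: the union of all bisimulations is again one. Transport from left to right suffices,
since the signature decides where an operator is defined and the operators are single valued. -/
theorem isBisimulation_crystalEquiv : IsBisimulation CrystalEquiv where
  sig_eq := fun ⟨_, hR, h⟩ => hR.sig_eq h
  f := fun ⟨R, hR, h⟩ _ _ hu => by
    obtain ⟨v', hv, h'⟩ := hR.f h hu
    exact ⟨v', hv, R, hR, h'⟩
  e := fun ⟨R, hR, h⟩ _ _ hu => by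
    obtain ⟨v', hv, h'⟩ := hR.e h hu
    exact ⟨v', hv, R, hR, h'⟩

namespace CrystalEquiv

theorem refl (u : List Letter) : CrystalEquiv u u :=
  ⟨Eq, ⟨by rintro u _ rfl i; rfl, by rintro u _ rfl i u' h; exact ⟨u', h, rfl⟩,
    by rintro u _ rfl i u' h; exact ⟨u', h, rfl⟩⟩, rfl⟩

theorem trans {u v w : List Letter} (h₁ : CrystalEquiv u v) (h₂ : CrystalEquiv v w) :
    CrystalEquiv u w := by
  have B := isBisimulation_crystalEquiv
  refine ⟨fun u w => ∃ v, CrystalEquiv u v ∧ CrystalEquiv v w, ⟨?_, ?_, ?_⟩, v, h₁, h₂⟩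
  · rintro u w ⟨v, h, h'⟩ i
    rw [B.sig_eq h, B.sig_eq h']
  · rintro u w ⟨v, h, h'⟩ i u' hu
    obtain ⟨v', hv, hv'⟩ := B.f h hu
    obtain ⟨w', hw, hw'⟩ := B.f h' hv
    exact ⟨w', hw, v', hv', hw'⟩
  · rintro u w ⟨v, h, h'⟩ i u' hu
    obtain ⟨v', hv, hv'⟩ := B.e h hu
    obtain ⟨w', hw, hw'⟩ := B.e h' hv
    exact ⟨w', hw, v', hv', hw'⟩

/-- The tensor product rule chooses the factor on which an operator acts from the signatures alone,
so equivalent factors lead to the same choice. With `append_left` this makes the equivalence a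
congruence for concatenation. -/
theorem append_right {u v : List Letter} (h : CrystalEquiv u v) (y : List Letter) :
    CrystalEquiv (u ++ y) (v ++ y) := by
  have B := isBisimulation_crystalEquiv
  refine ⟨fun a b => ∃ u v y, a = u ++ y ∧ b = v ++ y ∧ CrystalEquiv u v, ⟨?_, ?_, ?_⟩,
    u, v, y, rfl, rfl, h⟩
  · rintro _ _ ⟨u, v, y, rfl, rfl, h⟩ i
    rw [sig_append, sig_append, B.sig_eq h]
  · rintro _ _ ⟨u, v, y, rfl, rfl, h⟩ i a ha
    rw [fWord_append, B.sig_eq h i] at ha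
    rw [fWord_append]
    split_ifs at ha ⊢ with hc
    · obtain ⟨u', hu, rfl⟩ := Option.map_eq_some_iff.1 ha
      obtain ⟨v', hv, h'⟩ := B.f h hu
      exact ⟨v' ++ y, by rw [hv, Option.map_some], u', v', y, rfl, rfl, h'⟩
    · obtain ⟨y', hy, rfl⟩ := Option.map_eq_some_iff.1 ha
      exact ⟨v ++ y', by rw [hy, Option.map_some], u, v, y', rfl, rfl, h⟩
  · rintro _ _ ⟨u, v, y, rfl, rfl, h⟩ i a ha
    rw [eWord_append, B.sig_eq h i] at ha
    rw [eWord_append]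
    split_ifs at ha ⊢ with hc
    · obtain ⟨y', hy, rfl⟩ := Option.map_eq_some_iff.1 ha
      exact ⟨v ++ y', by rw [hy, Option.map_some], u, v, y', rfl, rfl, h⟩
    · obtain ⟨u', hu, rfl⟩ := Option.map_eq_some_iff.1 ha
      obtain ⟨v', hv, h'⟩ := B.e h hu
      exact ⟨v' ++ y, by rw [hv, Option.map_some], u', v', y, rfl, rfl, h'⟩

theorem append_left {u v : List Letter} (h : CrystalEquiv u v) (x : List Letter) :
    CrystalEquiv (x ++ u) (x ++ v) := by
  have B := isBisimulation_crystalEquiv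
  refine ⟨fun a b => ∃ x u v, a = x ++ u ∧ b = x ++ v ∧ CrystalEquiv u v, ⟨?_, ?_, ?_⟩,
    x, u, v, rfl, rfl, h⟩
  · rintro _ _ ⟨x, u, v, rfl, rfl, h⟩ i
    rw [sig_append, sig_append, B.sig_eq h]
  · rintro _ _ ⟨x, u, v, rfl, rfl, h⟩ i a ha
    rw [fWord_append, B.sig_eq h i] at ha
    rw [fWord_append]
    split_ifs at ha ⊢ with hc
    · obtain ⟨x', hx, rfl⟩ := Option.map_eq_some_iff.1 ha
      exact ⟨x' ++ v, by rw [hx, Option.map_some], x', u, v, rfl, rfl, h⟩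
    · obtain ⟨u', hu, rfl⟩ := Option.map_eq_some_iff.1 ha
      obtain ⟨v', hv, h'⟩ := B.f h hu
      exact ⟨x ++ v', by rw [hv, Option.map_some], x, u', v', rfl, rfl, h'⟩
  · rintro _ _ ⟨x, u, v, rfl, rfl, h⟩ i a ha
    rw [eWord_append, B.sig_eq h i] at ha
    rw [eWord_append]
    split_ifs at ha ⊢ with hc
    · obtain ⟨u', hu, rfl⟩ := Option.map_eq_some_iff.1 ha
      obtain ⟨v', hv, h'⟩ := B.e h hu
      exact ⟨x ++ v', by rw [hv, Option.map_some], x, u', v', rfl, rfl, h'⟩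
    · obtain ⟨x', hx, rfl⟩ := Option.map_eq_some_iff.1 ha
      exact ⟨x' ++ v, by rw [hx, Option.map_some], x', u, v, rfl, rfl, h⟩

/-- The weight is determined by its coroot pairings, and these are differences of signature entries.
-/
theorem wtWord_eq {u v : List Letter} (h : CrystalEquiv u v) : wtWord u = wtWord v := by
  have key : ∀ i, corootPairing (wtWord u) i = corootPairing (wtWord v) i := fun i => by
    rw [← sig_wt, ← sig_wt, isBisimulation_crystalEquiv.sig_eq h]
  exact Prod.ext (key .n1) (key .n2)

end CrystalEquiv

/-! ### Column insertion as a crystal equivalence -/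

/-- The new column and the bumped letter, if a letter is bumped. -/
def InsertResult.bumped : InsertResult → Option (Column × Letter)
  | .bump C y => some (C, y)
  | _ => none

theorem InsertResult.eq_bump_of_bumped {r : InsertResult} {C : Column} {y : Letter}
    (h : r.bumped = some (C, y)) : r = .bump C y := by
  cases r <;> simp_all [bumped]

/-- The pairs of words related by an insertion into a column that bumps a letter. -/
def bumpPairs : List (List Letter × List Letter) :=
  admissibleColumns.flatMap fun C =>
    [Letter.one, .two, .twoBar, .oneBar].filterMap fun x =>
      (insertColumn x C).bumped.map fun D => (C.letters ++ [x], D.2 :: D.1.letters)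

theorem bumpPairs_sig : ∀ w ∈ bumpPairs, ∀ i, sig i w.1 = sig i w.2 := by
  decide +kernel

/-- The finite set of bumping relations is itself a bisimulation, so no isomorphism of crystals has
to be constructed. Contractions never enter, because inserting `1` into a KN tableau causes none. -/
theorem bumpPairs_f : ∀ w ∈ bumpPairs, ∀ i, ∀ u ∈ fWord i w.1, ∃ v ∈ fWord i w.2,
    (u, v) ∈ bumpPairs := by
  decide +kernel

theorem bumpPairs_e : ∀ w ∈ bumpPairs, ∀ i, ∀ u ∈ eWord i w.1, ∃ v ∈ eWord i w.2,
    (u, v) ∈ bumpPairs := by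
  decide +kernel

theorem crystalEquiv_of_mem_bumpPairs {u v : List Letter} (h : (u, v) ∈ bumpPairs) :
    CrystalEquiv u v :=
  ⟨fun u v => (u, v) ∈ bumpPairs, ⟨fun h i => bumpPairs_sig _ h i,
    fun h _ _ hu => bumpPairs_f _ h _ _ hu, fun h _ _ hu => bumpPairs_e _ h _ _ hu⟩, h⟩

/-- The effect of inserting into `C` the top letter of a column to the left of `C`. -/
structure BumpsTop (P C : Column) : Prop where
  bumped : (insertColumn P.1 C).bumped = some (fixColumn (P.1, C.2), C.1)
  mem : (C.letters ++ [P.1], C.1 :: (fixColumn (P.1, C.2)).letters) ∈ bumpPairs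
  admissible : (fixColumn (P.1, C.2)).IsAdmissible
  height : (fixColumn (P.1, C.2)).letters.length = C.letters.length
  adjacent_top : Adjacent (fixColumn (P.1, C.2)) (C.1, none)
  adjacent : ∀ D ∈ admissibleColumns, Adjacent C D →
    Adjacent (fixColumn (P.1, C.2)) (fixColumn (C.1, D.2))

theorem bumpsTop_iff (P C : Column) : BumpsTop P C ↔
    (insertColumn P.1 C).bumped = some (fixColumn (P.1, C.2), C.1) ∧
    (C.letters ++ [P.1], C.1 :: (fixColumn (P.1, C.2)).letters) ∈ bumpPairs ∧
    (fixColumn (P.1, C.2)).IsAdmissible ∧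
    (fixColumn (P.1, C.2)).letters.length = C.letters.length ∧
    Adjacent (fixColumn (P.1, C.2)) (C.1, none) ∧
    ∀ D ∈ admissibleColumns, Adjacent C D →
      Adjacent (fixColumn (P.1, C.2)) (fixColumn (C.1, D.2)) :=
  ⟨fun ⟨a, b, c, d, e, f⟩ => ⟨a, b, c, d, e, f⟩, fun ⟨a, b, c, d, e, f⟩ => ⟨a, b, c, d, e, f⟩⟩

instance (P C : Column) : Decidable (BumpsTop P C) := decidable_of_iff' _ (bumpsTop_iff P C)

/-- All local facts about one insertion step, over the nine admissible columns; the statements on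
whole tableaux follow by induction along the chain of columns. -/
theorem bumpsTop_of_mem : ∀ P ∈ admissibleColumns, ∀ C ∈ admissibleColumns,
    Adjacent P C → BumpsTop P C := by
  decide +kernel

theorem Adjacent.bumpsTop {P C : Column} (h : Adjacent P C) : BumpsTop P C :=
  bumpsTop_of_mem P ((mem_admissibleColumns P).1 h.1) C ((mem_admissibleColumns C).1 h.2.1) h

/-- The columns `T` with the first row moved one box to the right, the letter of `P` coming in
from the left, and the column `(1, 1̄)` replaced by `(2, 2̄)`. -/
def shiftTab : Column → List Column → List Column
  | P, [] => [(P.1, none)]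
  | P, C :: T => fixColumn (P.1, C.2) :: shiftTab C T

theorem insertTab_eq_shiftTab {P : Column} {T : List Column}
    (h : (P :: T).IsChain Adjacent) : insertTab P.1 T = shiftTab P T := by
  induction T generalizing P with
  | nil => rfl
  | cons C T ih =>
    obtain ⟨h1, h2⟩ := List.isChain_cons_cons.1 h
    rw [insertTab, InsertResult.eq_bump_of_bumped h1.bumpsTop.bumped, shiftTab]
    simp only
    rw [ih h2]

theorem word_shiftTab {P : Column} {T : List Column} (h : (P :: T).IsChain Adjacent) :
    CrystalEquiv (word T ++ [P.1]) (word (shiftTab P T)) := by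
  induction T generalizing P with
  | nil => exact CrystalEquiv.refl _
  | cons C T ih =>
    obtain ⟨h1, h2⟩ := List.isChain_cons_cons.1 h
    rw [word_cons, shiftTab, word_cons, List.append_assoc]
    refine ((crystalEquiv_of_mem_bumpPairs h1.bumpsTop.mem).append_left (word T)).trans ?_
    -- The bumped top letter of `C` now ends the word of the remaining columns, so `C` takes over
    -- the role of `P`.
    rw [List.append_cons]
    exact (ih h2).append_right _

theorem shape_shiftTab {P : Column} {T : List Column} (h : (P :: T).IsChain Adjacent) :
    (shiftTab P T).map (fun C => C.letters.length) = T.map (fun C => C.letters.length) ++ [1] := by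
  induction T generalizing P with
  | nil => rfl
  | cons C T ih =>
    obtain ⟨h1, h2⟩ := List.isChain_cons_cons.1 h
    rw [shiftTab, List.map_cons, ih h2, h1.bumpsTop.height]; rfl

theorem adjacent_oneBar (x : Letter) : Adjacent (x, none) (.oneBar, none) := by
  revert x; decide +kernel

theorem isChain_shiftTab {P : Column} {T : List Column} (h : (P :: T).IsChain Adjacent) :
    (appendRow1 (shiftTab P T) .oneBar).IsChain Adjacent := by
  induction T generalizing P with
  | nil => simpa [shiftTab, appendRow1] using adjacent_oneBar P.1
  | cons C T ih =>
    obtain ⟨h1, h2⟩ := List.isChain_cons_cons.1 h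
    have h3 := ih h2
    cases T with
    | nil =>
      simp only [appendRow1, shiftTab, List.cons_append] at h3 ⊢
      exact List.isChain_cons_cons.2 ⟨h1.bumpsTop.adjacent_top, h3⟩
    | cons D T =>
      have h4 := (List.isChain_cons_cons.1 h2).1
      simp only [appendRow1, shiftTab, List.cons_append] at h3 ⊢
      exact List.isChain_cons_cons.2 ⟨h1.bumpsTop.adjacent D
        ((mem_admissibleColumns D).1 h4.2.1) h4, h3⟩

theorem admissible_shiftTab {P : Column} {T : List Column} (h : (P :: T).IsChain Adjacent) :
    ∀ C ∈ shiftTab P T, C.IsAdmissible := by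
  induction T generalizing P with
  | nil =>
    simp only [shiftTab, List.mem_singleton, forall_eq]
    exact (adjacent_oneBar P.1).1
  | cons C T ih =>
    obtain ⟨h1, h2⟩ := List.isChain_cons_cons.1 h
    exact List.forall_mem_cons.2 ⟨h1.bumpsTop.admissible, ih h2⟩

theorem fixColumn_none (x : Letter) : fixColumn (x, none) = (x, none) := by
  simp [fixColumn]

/-- Adjacency makes heights weakly decrease. Hence cutting the tableau into rows and reassembling it
keeps every second row entry in its column. -/
theorem row2_eq_nil {a : Letter} {T : List Column} (h : ((a, none) :: T).IsChain Adjacent) :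
    row2 T = [] := by
  rw [List.isChain_iff_pairwise, List.pairwise_cons] at h
  rw [row2, List.filterMap_eq_nil_iff]
  rintro ⟨c, _ | d⟩ hC
  · rfl
  · have := (h.1 _ hC).2.2.1
    simp [Column.letters] at this

theorem map_fixColumn_ofRows {P : Column} {T : List Column} (h : (P :: T).IsChain Adjacent) :
    (ofRows (P.1 :: row1 T ++ [.oneBar]) (row2 T)).map fixColumn =
      appendRow1 (shiftTab P T) .oneBar := by
  induction T generalizing P with
  | nil => simp [row1, row2, ofRows, shiftTab, appendRow1, fixColumn_none]
  | cons C T ih =>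
    obtain ⟨h1, h2⟩ := List.isChain_cons_cons.1 h
    have h3 := ih h2
    obtain ⟨a, _ | b⟩ := C
    · have hr : row2 ((a, none) :: T) = [] := by
        rw [← row2_eq_nil h2]; rfl
      rw [row2_eq_nil h2] at h3
      rw [hr]
      simpa [row1, ofRows, shiftTab, appendRow1] using h3
    · have hr : row2 ((a, some b) :: T) = b :: row2 T := rfl
      rw [hr]
      simpa [row1, ofRows, shiftTab, appendRow1] using h3

theorem adjacent_highest {C : Column} (h : C.IsAdmissible) : Adjacent (.one, some .two) C := by
  revert C; decide +kernel

/-- The column `(1, 2)` is a virtual left neighbour of every KN tableau. Its top letter is the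
inserted `1`, so the insertion becomes an instance of the general shift. -/
theorem KN.isChain {p q : ℕ} (T : KN p q) :
    ((Letter.one, some Letter.two) :: T.1).IsChain Adjacent := by
  obtain ⟨T, hT⟩ := T
  obtain ⟨-, h1, h2⟩ := (isKN_iff p q T).1 hT
  cases T with
  | nil => simp
  | cons C T =>
    exact List.isChain_cons_cons.2 ⟨adjacent_highest (h1 C (by simp)), h2⟩

/-- Adds `1` at the beginning and `1̄` at the end of the first row. -/
def KN.extend {p q : ℕ} (T : KN p q) : KN (p + 2) q :=
  ⟨appendRow1 (shiftTab (.one, some .two) T.1) .oneBar, by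
    refine (isKN_iff _ _ _).2 ⟨?_, ?_, isChain_shiftTab T.isChain⟩
    · rw [appendRow1, List.map_append, shape_shiftTab T.isChain, ((isKN_iff p q T.1).1 T.2).1,
        List.replicate_add]
      simp [Column.letters]
    · rw [appendRow1]
      intro C hC
      rcases List.mem_append.1 hC with h | h
      · exact admissible_shiftTab T.isChain C h
      · rw [List.mem_singleton.1 h]; exact (adjacent_oneBar .one).2.1⟩

theorem KN.word_extend {p q : ℕ} (T : KN p q) :
    CrystalEquiv (.oneBar :: (word T.1 ++ [.one])) (word T.extend.1) := by
  have h : word T.extend.1 = [.oneBar] ++ word (shiftTab (.one, some .two) T.1) := by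
    simp [KN.extend, appendRow1, word, Column.letters]
  rw [h]
  exact (word_shiftTab T.isChain).append_left [.oneBar]

/-! ### Strings -/

theorem iter_succ' {α : Type*} (g : α → Option α) (k : ℕ) (b : α) :
    iter g (k + 1) b = (g b).bind (iter g k) := by
  induction k with
  | zero => exact (Option.bind_fun_some (g b)).symm
  | succ k ih => rw [iter, ih, Option.bind_assoc]; rfl

theorem iter_reverse {α : Type*} {e f : α → Option α}
    (h : ∀ b b', e b = some b' → f b' = some b) {n : ℕ} {b b' : α}
    (hb : iter e n b = some b') : iter f n b' = some b := by
  induction n generalizing b' with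
  | zero => simp only [iter, Option.some.injEq] at hb ⊢; exact hb.symm
  | succ n ih =>
    obtain ⟨c, hc, hc'⟩ := Option.bind_eq_some_iff.1 hb
    rw [iter_succ', h _ _ hc', Option.bind_some, ih hc]

namespace Crystal

variable (B : Crystal)

theorem iter_eMax (i : Node) (b : B.carrier) :
    iter (B.e i) (B.eps i b) b = some (B.eMax i b) := by
  obtain ⟨c, hc⟩ := Option.ne_none_iff_exists'.1 (B.eps_max i b).1
  rw [eMax, hc, Option.getD_some]

/-- Each maximal raising is undone by equally many lowerings. That the raised vertex is the highest
one is specific to KN tableaux and is proved separately. -/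
theorem lower_str (i j : Node) (b : B.carrier) :
    B.lower i j (B.str i j b) (B.eMax j (B.eMax i (B.eMax j (B.eMax i b)))) = some b := by
  have h : ∀ i b, iter (B.f i) (B.eps i b) (B.eMax i b) = some b := fun i b =>
    iter_reverse (fun b b' => (B.e_eq_iff i b b').1) (B.iter_eMax i b)
  simp only [lower, str, h, Option.bind_some]

end Crystal

/-- `eᵢ^max` on words. -/
def eMaxWord (i : Node) (w : List Letter) : List Letter :=
  (iter (eWord i) (sig i w).1 w).getD w

/-- The adapted string of a word. -/
def strWord (i j : Node) (w : List Letter) : ℕ × ℕ × ℕ × ℕ :=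
  ((sig i w).1, (sig j (eMaxWord i w)).1, (sig i (eMaxWord j (eMaxWord i w))).1,
    (sig j (eMaxWord i (eMaxWord j (eMaxWord i w)))).1)

theorem iter_eWord_of_le {i : Node} {w : List Letter} {k : ℕ} (h : k ≤ (sig i w).1) :
    ∃ w', iter (eWord i) k w = some w' ∧ (sig i w').1 = (sig i w).1 - k := by
  induction k with
  | zero => exact ⟨w, rfl, rfl⟩
  | succ k ih =>
    obtain ⟨u, hu, hs⟩ := ih (by omega)
    obtain ⟨v, hv, -, hs'⟩ := (eWord_spec i u).2 (by omega)
    exact ⟨v, by rw [iter, hu, Option.bind_some, hv], by rw [hs']; simp only; omega⟩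

theorem eMaxWord_spec (i : Node) (w : List Letter) :
    iter (eWord i) (sig i w).1 w = some (eMaxWord i w) ∧ (sig i (eMaxWord i w)).1 = 0 := by
  obtain ⟨u, hu, hs⟩ := iter_eWord_of_le (le_refl (sig i w).1)
  rw [eMaxWord, hu, Option.getD_some]
  exact ⟨rfl, by omega⟩

theorem CrystalEquiv.iter_eWord {u v : List Letter} (h : CrystalEquiv u v) {i : Node} {k : ℕ}
    {u' : List Letter} (hu : iter (eWord i) k u = some u') :
    ∃ v', iter (eWord i) k v = some v' ∧ CrystalEquiv u' v' := by
  induction k generalizing u' with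
  | zero => cases hu; exact ⟨v, rfl, h⟩
  | succ k ih =>
    obtain ⟨a, ha, ha'⟩ := Option.bind_eq_some_iff.1 hu
    obtain ⟨b, hb, hab⟩ := ih ha
    obtain ⟨v', hv, h'⟩ := isBisimulation_crystalEquiv.e hab ha'
    exact ⟨v', by rw [iter, hb, Option.bind_some, hv], h'⟩

theorem CrystalEquiv.eMaxWord {u v : List Letter} (h : CrystalEquiv u v) (i : Node) :
    CrystalEquiv (eMaxWord i u) (eMaxWord i v) := by
  obtain ⟨v', hv, h'⟩ := h.iter_eWord (eMaxWord_spec i u).1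
  rw [isBisimulation_crystalEquiv.sig_eq h i, (eMaxWord_spec i v).1] at hv
  cases hv
  exact h'

theorem CrystalEquiv.strWord {u v : List Letter} (h : CrystalEquiv u v) (i j : Node) :
    strWord i j u = strWord i j v := by
  have B := isBisimulation_crystalEquiv
  rw [C2.strWord, C2.strWord, B.sig_eq h, B.sig_eq (h.eMaxWord i),
    B.sig_eq ((h.eMaxWord i).eMaxWord j), B.sig_eq (((h.eMaxWord i).eMaxWord j).eMaxWord i)]

/-- No `+` of `x` can cancel a `-` of `w`, and `y` offers no `-` further to the right, so the
rightmost surviving `-` stays in the middle factor. -/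
theorem iter_eWord_append {i : Node} {x w w' y : List Letter} {k : ℕ}
    (h : iter (eWord i) k w = some w') (hx : (sig i x).2 = 0) (hy : (sig i y).1 = 0) :
    iter (eWord i) k (x ++ (w ++ y)) = some (x ++ (w' ++ y)) := by
  induction k generalizing w' with
  | zero => cases h; rfl
  | succ k ih =>
    obtain ⟨a, ha, ha'⟩ := Option.bind_eq_some_iff.1 h
    have hs := (eWord_sig ha').1
    rw [iter, ih ha, Option.bind_some, eWord_append, sig_append,
      if_pos (by simp only; omega), eWord_append, if_neg (by omega), ha']
    rfl

/-- Framing a word by a letter not labelled `+` and the letter `1`. -/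
theorem sig_frame {i : Node} {z : Letter} (hz : label i z ≠ 1) (w : List Letter) :
    (sig i (z :: (w ++ [.one]))).1 = (sig i w).1 + if label i z = -1 then 1 else 0 := by
  have h1 : (sig i [.one]).1 = 0 := by cases i <;> decide
  rcases label_cases i z with h | h | h
  · exact absurd h hz
  · rw [sig_cons_neg _ h, sig_append, if_pos h]; simp only; omega
  · rw [sig_cons_zero _ h, sig_append, if_neg (by rw [h]; decide)]; simp only; omega

/-- A front letter labelled `-` carries the leftmost surviving `-`, so it is changed last, after the
middle factor is exhausted. -/
theorem eMaxWord_frame {i : Node} {z : Letter} (hz : label i z ≠ 1) (w : List Letter) :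
    eMaxWord i (z :: (w ++ [.one])) = eLetter i z :: (eMaxWord i w ++ [.one]) := by
  have h1 : (sig i [.one]).1 = 0 := by cases i <;> decide
  have h2 : (sig i [z]).2 = 0 := by revert i z; decide
  obtain ⟨hw, hs⟩ := eMaxWord_spec i w
  have key := iter_eWord_append hw h2 h1
  simp only [List.cons_append, List.nil_append] at key
  have hM := (eMaxWord_spec i (z :: (w ++ [.one]))).1
  rw [sig_frame hz] at hM
  by_cases h : label i z = -1
  · rw [if_pos h, iter, key, Option.bind_some, eWord, sig_append,
      if_pos ⟨h, by simp only; omega⟩] at hM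
    exact (Option.some.inj hM).symm
  · rw [if_neg h, Nat.add_zero, key] at hM
    -- An unlabelled letter is fixed by `eLetter`, which makes the formula uniform in `z`.
    have : eLetter i z = z := by
      clear * - hz h
      revert i z; decide
    rw [this]
    exact (Option.some.inj hM).symm

theorem strWord_frame_one {w : List Letter} {a b c d : ℕ}
    (h : strWord .n1 .n2 w = (a, b, c, d)) :
    strWord .n1 .n2 (.oneBar :: (w ++ [.one])) = (a + 1, b + 1, c + 1, d) := by
  simp only [strWord, Prod.mk.injEq] at h ⊢
  obtain ⟨rfl, rfl, rfl, rfl⟩ := h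
  have l1 : label .n1 .oneBar ≠ 1 := by decide
  have l2 : label .n2 .twoBar ≠ 1 := by decide
  have l3 : label .n1 .two ≠ 1 := by decide
  have l4 : label .n2 .one ≠ 1 := by decide
  simp only [eMaxWord_frame l1, sig_frame l1, show eLetter .n1 .oneBar = .twoBar from rfl,
    eMaxWord_frame l2, sig_frame l2, show eLetter .n2 .twoBar = .two from rfl,
    eMaxWord_frame l3, sig_frame l3, show eLetter .n1 .two = .one from rfl, sig_frame l4]
  exact ⟨rfl, rfl, rfl, rfl⟩

theorem strWord_frame_two {w : List Letter} {a b c d : ℕ}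
    (h : strWord .n2 .n1 w = (a, b, c, d)) :
    strWord .n2 .n1 (.oneBar :: (w ++ [.one])) = (a, b + 1, c + 1, d + 1) := by
  simp only [strWord, Prod.mk.injEq] at h ⊢
  obtain ⟨rfl, rfl, rfl, rfl⟩ := h
  have l0 : label .n2 .oneBar ≠ 1 := by decide
  have l1 : label .n1 .oneBar ≠ 1 := by decide
  have l2 : label .n2 .twoBar ≠ 1 := by decide
  have l3 : label .n1 .two ≠ 1 := by decide
  simp only [eMaxWord_frame l0, sig_frame l0, show eLetter .n2 .oneBar = .oneBar from rfl,
    eMaxWord_frame l1, sig_frame l1, show eLetter .n1 .oneBar = .twoBar from rfl,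
    eMaxWord_frame l2, sig_frame l2, show eLetter .n2 .twoBar = .two from rfl, sig_frame l3]
  exact ⟨rfl, rfl, rfl, rfl⟩

/-! ### Strings of tableaux computed on words -/

section
variable {p q : ℕ}

theorem KN.iter_e {i : Node} {k : ℕ} {T U : KN p q} (h : iter (KN.e i) k T = some U) :
    iter (eWord i) k (word T.1) = some (word U.1) := by
  induction k generalizing U with
  | zero => cases h; rfl
  | succ k ih =>
    obtain ⟨V, hV, hV'⟩ := Option.bind_eq_some_iff.1 h
    rw [iter, ih hV, Option.bind_some]
    exact ((eTab_iff _ _ _).1 ((KN.e_eq_some _ _ _).1 hV')).1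

theorem word_eMax (i : Node) (T : KN p q) :
    word ((crystal p q).eMax i T).1 = eMaxWord i (word T.1) := by
  have h := KN.iter_e ((crystal p q).iter_eMax i T)
  have h' := (eMaxWord_spec i (word T.1)).1
  exact Option.some.inj (h.symm.trans h')

theorem crystal_eps (i : Node) (T : KN p q) :
    (crystal p q).eps i T = (sig i (word T.1)).1 := rfl

theorem str_eq_strWord (i j : Node) (T : KN p q) :
    (crystal p q).str i j T = strWord i j (word T.1) := by
  have h1 := word_eMax i T
  have h2 := word_eMax j ((crystal p q).eMax i T)
  have h3 := word_eMax i ((crystal p q).eMax j ((crystal p q).eMax i T))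
  rw [h1] at h2
  rw [h2] at h3
  have e1 := crystal_eps i T
  have e2 := (crystal_eps j ((crystal p q).eMax i T)).trans (congrArg (fun w => (sig j w).1) h1)
  have e3 := (crystal_eps i ((crystal p q).eMax j ((crystal p q).eMax i T))).trans
    (congrArg (fun w => (sig i w).1) h2)
  have e4 := (crystal_eps j ((crystal p q).eMax i ((crystal p q).eMax j
    ((crystal p q).eMax i T)))).trans (congrArg (fun w => (sig j w).1) h3)
  have key : ∀ {a b c d a' b' c' d' : ℕ}, a = a' → b = b' → c = c' → d = d' →
      (a, b, c, d) = (a', b', c', d') := by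
    rintro _ _ _ _ _ _ _ _ rfl rfl rfl rfl; rfl
  exact key e1 e2 e3 e4

end

/-! ### Elements with vanishing `εᵢ` -/

theorem phi_word_eq_zero {i : Node} {T : List Column} (h : ∀ C ∈ T, (sig i C.letters).2 = 0) :
    (sig i (word T)).2 = 0 := by
  induction T with
  | nil => rfl
  | cons C T ih =>
    rw [List.forall_mem_cons] at h
    rw [sig_word_cons, h.1, ih h.2]; omega

/-- Induction from the right end of the tableau. Only a `+` of a column further right can cancel a
`-` of `C`; if those columns lie in `S'` and carry no surviving `+`, a column `C` outside `S'` would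
force `εᵢ` to be positive. -/
theorem forall_mem_of_eps_eq_zero {i : Node} {S S' : List Column}
    (hS : ∀ C ∈ S, C ∉ S' → (sig i C.letters).1 ≠ 0 ∧
      ∀ D ∈ S', Adjacent C D → (sig i D.letters).2 = 0)
    {T : List Column} (hT : T.IsChain Adjacent) (hTS : ∀ C ∈ T, C ∈ S)
    (h : (sig i (word T)).1 = 0) : ∀ C ∈ T, C ∈ S' := by
  rw [List.isChain_iff_pairwise] at hT
  induction T with
  | nil => simp
  | cons C T ih =>
    rw [word_cons, sig_append] at h
    simp only at h
    rw [List.pairwise_cons] at hT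
    rw [List.forall_mem_cons] at hTS ⊢
    have hT' := ih hT.2 hTS.2 (by omega)
    refine ⟨by_contra fun hC => ?_, hT'⟩
    obtain ⟨h1, h2⟩ := hS C hTS.1 hC
    have := phi_word_eq_zero (i := i) fun D hD => h2 D (hT' D hD) (hT.1 D hD)
    omega

/-- `eᵢ` changes one column; the columns to its left carry no surviving `-`. -/
theorem exists_append_of_eTab {i : Node} {T U : List Column} (h : eTab i T = some U) :
    ∃ A C C' B, T = A ++ C :: B ∧ U = A ++ C' :: B ∧ eTab i [C] = some [C'] ∧
      (sig i (word A)).1 ≤ (sig i (word (C :: B))).2 := by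
  rw [eTab_iff_fTab] at h
  induction U generalizing T with
  | nil => exact absurd h (fTab_nil i T)
  | cons D U ih =>
    rcases fTab_cons i D U T h with ⟨V, rfl, hc, h'⟩ | ⟨D', rfl, -, h'⟩
    · obtain ⟨A, C, C', B, rfl, rfl, hC, hs⟩ := ih h'
      refine ⟨D :: A, C, C', B, rfl, rfl, hC, ?_⟩
      -- The strict inequality `hc` concerns the tableau before `fᵢ`. Applying `fᵢ` lowers `φᵢ` by
      -- one, which leaves the weak inequality needed.
      have h2 := (fWord_sig ((fTab_iff _ _ _).1 h').1).2.2
      have h3 : word (A ++ C :: B) = word (C :: B) ++ word A := by simp [word]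
      rw [h3, sig_append] at h2
      have h4 := congrArg Prod.snd h2
      simp only at h4
      rw [word_cons, sig_append]
      simp only
      omega
    · exact ⟨[], D', D, U, rfl, rfl, (eTab_iff_fTab _ _ _).2 h', Nat.zero_le _⟩

/-- A step of `eᵢ` on a tableau with columns in `S` stays in `S`, or changes the column `C` while
all columns to the left of it lie in `S'`. -/
theorem eTab_mem {i : Node} {S S' : List Column} {C₀ C₁ : Column}
    (hS : ∀ C ∈ S, ∀ U ∈ eTab i [C], (∀ D ∈ U, D ∈ S) ∨ (C = C₀ ∧ U = [C₁]))
    (hphi : ∀ D ∈ S, D = C₀ ∨ Adjacent C₀ D → (sig i D.letters).2 = 0)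
    (hS' : ∀ C ∈ S, C ∉ S' → (sig i C.letters).1 ≠ 0 ∧
      ∀ D ∈ S', Adjacent C D → (sig i D.letters).2 = 0)
    {T U : List Column} (hT : T.IsChain Adjacent) (hTS : ∀ C ∈ T, C ∈ S)
    (h : eTab i T = some U) :
    (∀ C ∈ U, C ∈ S) ∨ (∀ C ∈ U, C ∈ S' ∨ C = C₁ ∨ C ∈ S ∧ Adjacent C₀ C) := by
  obtain ⟨A, C, C', B, rfl, rfl, hC, hs⟩ := exists_append_of_eTab h
  have hCS := hTS C (by simp)
  have hBS : ∀ D ∈ B, D ∈ S := fun D hD => hTS D (by simp [hD])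
  have hAS : ∀ D ∈ A, D ∈ S := fun D hD => hTS D (by simp [hD])
  rw [List.isChain_append] at hT
  rcases hS C hCS _ hC with h1 | ⟨rfl, h1⟩
  · left
    intro D hD
    rcases List.mem_append.1 hD with hD | hD
    · exact hAS D hD
    · rcases List.mem_cons.1 hD with rfl | hD
      · exact h1 _ (by simp)
      · exact hBS D hD
  · right
    cases h1
    have hB := hT.2.1
    rw [List.isChain_iff_pairwise, List.pairwise_cons] at hB
    -- With no `+` surviving in `C` and to its right, the columns `A` to the left must have `εᵢ = 0`
    -- on their own.
    have hz : (sig i (word (C :: B))).2 = 0 := phi_word_eq_zero fun D hD => by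
      rcases List.mem_cons.1 hD with rfl | hD
      · exact hphi _ hCS (Or.inl rfl)
      · exact hphi D (hBS D hD) (Or.inr (hB.1 D hD))
    have hA := forall_mem_of_eps_eq_zero hS' hT.1 hAS (by omega)
    intro D hD
    rcases List.mem_append.1 hD with hD | hD
    · exact Or.inl (hA D hD)
    · rcases List.mem_cons.1 hD with rfl | hD
      · exact Or.inr (Or.inl rfl)
      · exact Or.inr (Or.inr ⟨hBS D hD, hB.1 D hD⟩)

theorem eTab_mem_of_closed {i : Node} {S : List Column}
    (hS : ∀ C ∈ S, ∀ U ∈ eTab i [C], ∀ D ∈ U, D ∈ S)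
    {T U : List Column} (hTS : ∀ C ∈ T, C ∈ S) (h : eTab i T = some U) : ∀ C ∈ U, C ∈ S := by
  obtain ⟨A, C, C', B, rfl, rfl, hC, -⟩ := exists_append_of_eTab h
  have h1 := hS C (hTS C (by simp)) _ hC
  intro D hD
  rcases List.mem_append.1 hD with hD | hD
  · exact hTS D (by simp [hD])
  · rcases List.mem_cons.1 hD with rfl | hD
    · exact h1 _ (by simp)
    · exact hTS D (by simp [hD])

/-! ### The adapted string leads to the highest weight vertex -/

section
variable {p q : ℕ}

theorem eps_eMax (i : Node) (T : KN p q) :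
    (sig i (word ((crystal p q).eMax i T).1)).1 = 0 := by
  rw [word_eMax]; exact (eMaxWord_spec i _).2

theorem eMax_induction {i : Node} {Q : List Column → Prop}
    (hQ : ∀ T U : KN p q, Q T.1 → eTab i T.1 = some U.1 → Q U.1) {T : KN p q} (hT : Q T.1) :
    Q ((crystal p q).eMax i T).1 := by
  have key : ∀ (k : ℕ) (U : KN p q), iter (KN.e i) k T = some U → Q U.1 := by
    intro k
    induction k with
    | zero => intro U h; cases h; exact hT
    | succ k ih =>
      intro U h
      obtain ⟨V, hV, hV'⟩ := Option.bind_eq_some_iff.1 h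
      exact hQ V U (ih V hV) ((KN.e_eq_some _ _ _).1 hV')
  exact key _ _ ((crystal p q).iter_eMax i T)

theorem KN.isChain_adjacent (T : KN p q) : T.1.IsChain Adjacent := ((isKN_iff p q T.1).1 T.2).2.2

/-- Raising stays in the closed set `S`, and at the end the vanishing of `εᵢ` cuts `S` down to `S'`.
-/
theorem eMax_mem {i : Node} {S S' : List Column}
    (hS : ∀ C ∈ S, ∀ U ∈ eTab i [C], ∀ D ∈ U, D ∈ S)
    (hS' : ∀ C ∈ S, C ∉ S' → (sig i C.letters).1 ≠ 0 ∧
      ∀ D ∈ S', Adjacent C D → (sig i D.letters).2 = 0)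
    {T : KN p q} (hT : ∀ C ∈ T.1, C ∈ S) : ∀ C ∈ ((crystal p q).eMax i T).1, C ∈ S' :=
  forall_mem_of_eps_eq_zero hS' (KN.isChain_adjacent _)
    (eMax_induction (Q := fun T => ∀ C ∈ T, C ∈ S)
      (fun _ _ hT h => eTab_mem_of_closed hS hT h) hT) (eps_eMax i T)

/-- A variant of `eMax_mem`, where `eᵢ` may lead from tableaux with columns in `S` to tableaux with
columns in `R` by changing the column `C₀` to `C₁`. -/
theorem eMax_mem_of_exit {i : Node} {S S' R S'' : List Column} {C₀ C₁ : Column}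
    (hS : ∀ C ∈ S, ∀ U ∈ eTab i [C], (∀ D ∈ U, D ∈ S) ∨ (C = C₀ ∧ U = [C₁]))
    (hphi : ∀ D ∈ S, D = C₀ ∨ Adjacent C₀ D → (sig i D.letters).2 = 0)
    (hS' : ∀ C ∈ S, C ∉ S' → (sig i C.letters).1 ≠ 0 ∧
      ∀ D ∈ S', Adjacent C D → (sig i D.letters).2 = 0)
    (hR : (∀ C ∈ S', C ∈ R) ∧ C₁ ∈ R ∧ ∀ C ∈ S, Adjacent C₀ C → C ∈ R)
    (hRe : ∀ C ∈ R, ∀ U ∈ eTab i [C], ∀ D ∈ U, D ∈ R)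
    (hSS : ∀ C ∈ S', C ∈ S'')
    (hRS : ∀ C ∈ R, C ∉ S'' → (sig i C.letters).1 ≠ 0 ∧
      ∀ D ∈ S'', Adjacent C D → (sig i D.letters).2 = 0)
    {T : KN p q} (hT : ∀ C ∈ T.1, C ∈ S) : ∀ C ∈ ((crystal p q).eMax i T).1, C ∈ S'' := by
  have key := eMax_induction (i := i) (T := T)
    (Q := fun T => (∀ C ∈ T, C ∈ S) ∨ ∀ C ∈ T, C ∈ R) (fun T U hT h => by
      rcases hT with hT | hT
      · rcases eTab_mem hS hphi hS' T.isChain_adjacent hT h with h | h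
        · exact Or.inl h
        · refine Or.inr fun C hC => ?_
          rcases h C hC with h | rfl | h
          · exact hR.1 C h
          · exact hR.2.1
          · exact hR.2.2 C h.1 h.2
      · exact Or.inr (eTab_mem_of_closed hRe hT h)) (Or.inl hT)
  rcases key with h | h
  · exact fun C hC => hSS C
      (forall_mem_of_eps_eq_zero hS' (KN.isChain_adjacent _) h (eps_eMax i T) C hC)
  · exact forall_mem_of_eps_eq_zero hRS (KN.isChain_adjacent _) h (eps_eMax i T)

theorem eq_highest {T : KN p q}
    (h : ∀ C ∈ T.1, C ∈ ([(.one, some .two), (.one, none)] : List Column)) :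
    T = KN.highest p q := by
  apply Subtype.ext
  -- For these two columns the height determines the column, so the shape determines `T`.
  have h1 : T.1.map ((fun n => if n = 2 then (.one, some .two) else (.one, none)) ∘
      fun C : Column => C.letters.length) = T.1.map id := by
    refine List.map_congr_left fun C hC => ?_
    rcases List.mem_pair.1 (h C hC) with rfl | rfl <;> rfl
  rw [← List.map_map, T.2.shape, List.map_id] at h1
  rw [← h1]
  simp [KN.highest, highestColumns]

theorem eMax_string_one (T : KN p q) :
    (crystal p q).eMax .n2 ((crystal p q).eMax .n1 ((crystal p q).eMax .n2
      ((crystal p q).eMax .n1 T))) = KN.highest p q := by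
  have h0 : ∀ C ∈ T.1, C ∈ admissibleColumns := fun C hC =>
    (mem_admissibleColumns C).1 (T.2.admissible C hC)
  have h1 := eMax_mem (i := .n1) (S' := [(.one, none), (.two, none), (.twoBar, none),
    (.one, some .two), (.one, some .twoBar), (.two, some .twoBar), (.two, some .oneBar),
    (.twoBar, some .oneBar)]) (by decide +kernel) (by decide +kernel) h0
  have h2 := eMax_mem (i := .n2) (S' := [(.one, none), (.two, none), (.one, some .two),
    (.one, some .twoBar), (.two, some .twoBar), (.two, some .oneBar)])
    (by decide +kernel) (by decide +kernel) h1
  have h3 := eMax_mem (i := .n1) (S' := [(.one, none), (.one, some .two),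
    (.one, some .twoBar)]) (by decide +kernel) (by decide +kernel) h2
  exact eq_highest (eMax_mem (by decide +kernel) (by decide +kernel) h3)

theorem eMax_string_two (T : KN p q) :
    (crystal p q).eMax .n1 ((crystal p q).eMax .n2 ((crystal p q).eMax .n1
      ((crystal p q).eMax .n2 T))) = KN.highest p q := by
  have h0 : ∀ C ∈ T.1, C ∈ admissibleColumns := fun C hC =>
    (mem_admissibleColumns C).1 (T.2.admissible C hC)
  have h1 := eMax_mem (i := .n2) (S' := [(.one, none), (.two, none), (.oneBar, none),
    (.one, some .two), (.one, some .twoBar), (.two, some .twoBar), (.two, some .oneBar)])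
    (by decide +kernel) (by decide +kernel) h0
  have h2 := eMax_mem_of_exit (i := .n1) (C₀ := (.oneBar, none)) (C₁ := (.twoBar, none))
    (S' := [(.one, none), (.one, some .two), (.one, some .twoBar)])
    (R := [(.one, none), (.twoBar, none), (.oneBar, none), (.one, some .two),
      (.one, some .twoBar)])
    (S'' := [(.one, none), (.twoBar, none), (.one, some .two), (.one, some .twoBar)])
    (by decide +kernel) (by decide +kernel) (by decide +kernel) (by decide +kernel)
    (by decide +kernel) (by decide +kernel) (by decide +kernel) h1
  -- The same obstruction: a box `2` to the right would cancel the `-` of a column `(1, 2̄)`, but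
  -- `2̄` becomes `2` only after all such columns are gone.
  have h3 := eMax_mem_of_exit (i := .n2) (C₀ := (.twoBar, none)) (C₁ := (.two, none))
    (S' := [(.one, none), (.one, some .two)])
    (R := [(.one, none), (.two, none), (.twoBar, none), (.one, some .two)])
    (S'' := [(.one, none), (.two, none), (.one, some .two)])
    (by decide +kernel) (by decide +kernel) (by decide +kernel) (by decide +kernel)
    (by decide +kernel) (by decide +kernel) (by decide +kernel) h2
  exact eq_highest (eMax_mem (by decide +kernel) (by decide +kernel) h3)

theorem lower_str_highest {i j : Node} (hij : i ≠ j) (T : KN p q) :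
    (crystal p q).lower i j ((crystal p q).str i j T) (KN.highest p q) = some T := by
  have h := (crystal p q).lower_str i j T
  cases i <;> cases j
  · exact absurd rfl hij
  · rw [← eMax_string_one T]; exact h
  · rw [← eMax_string_two T]; exact h
  · exact absurd rfl hij

/-- A tableau is determined by the place of its word in the crystal of words. -/
theorem KN.eq_of_crystalEquiv {w : List Letter} {T U : KN p q}
    (hT : CrystalEquiv w (word T.1)) (hU : CrystalEquiv w (word U.1)) : T = U := by
  have h : (crystal p q).str .n1 .n2 T = (crystal p q).str .n1 .n2 U := by
    rw [str_eq_strWord, str_eq_strWord, ← hT.strWord, hU.strWord]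
  have hij : Node.n1 ≠ Node.n2 := by decide
  have h1 := lower_str_highest hij T
  rw [h, lower_str_highest hij U] at h1
  exact (Option.some.inj h1).symm

/-! ### The embedding -/

/-- On the framed word `fᵢ` acts inside the word of `T`: the final `1` offers no `-` to cancel and
at most a `+` further right, and `1̄` in front offers no `+`. -/
theorem KN.f_extend {i : Node} {T T' : KN p q} (h : KN.f i T = some T') :
    KN.f i T.extend = some T'.extend := by
  have hw := ((fTab_iff _ _ _).1 ((KN.f_eq_some _ _ _).1 h)).1
  have h1 : (sig i [.one]).1 = 0 := by cases i <;> decide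
  have h2 : (sig i [.oneBar]).2 = 0 := by cases i <;> decide
  have hx : fWord i (.oneBar :: (word T.1 ++ [.one])) = some (.oneBar :: (word T'.1 ++ [.one])) := by
    have hs := (fWord_sig hw).1
    rw [← List.singleton_append, fWord_append, if_neg (by omega), fWord_append,
      if_pos (by omega), hw]
    rfl
  obtain ⟨v, hv, hxv⟩ := isBisimulation_crystalEquiv.f T.word_extend hx
  obtain ⟨U, hU⟩ := KN.f_ne_none (fWord_sig hv).1
  have hw' := ((fTab_iff _ _ _).1 ((KN.f_eq_some _ _ _).1 hU)).1
  rw [hv] at hw'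
  cases hw'
  -- The words of `U` and of `T'.extend` are both equivalent to the framed word of `T'`, so the
  -- tableaux coincide.
  rw [hU, KN.eq_of_crystalEquiv hxv T'.word_extend]

theorem KN.e_extend {i : Node} {T T' : KN p q} (h : KN.e i T = some T') :
    KN.e i T.extend = some T'.extend :=
  (KN.e_eq_iff _ _ _).2 (KN.f_extend ((KN.e_eq_iff _ _ _).1 h))

/-- Both framing letters are unlabelled for the index `2`. This is why vanishing is detected for
this index. -/
theorem KN.sig_extend_two (T : KN p q) : sig .n2 (word T.extend.1) = sig .n2 (word T.1) := by
  rw [← isBisimulation_crystalEquiv.sig_eq T.word_extend, sig_cons_zero _ (by decide), sig_append,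
    show sig .n2 [.one] = (0, 0) from rfl]
  simp

theorem KN.e_extend_two (T : KN p q) : KN.e .n2 T.extend = (KN.e .n2 T).map KN.extend := by
  rcases h : KN.e .n2 T with _ | T'
  · rcases h' : KN.e .n2 T.extend with _ | U
    · rfl
    · have := (eWord_sig ((eTab_iff _ _ _).1 ((KN.e_eq_some _ _ _).1 h')).1).1
      rw [T.sig_extend_two] at this
      obtain ⟨V, hV⟩ := KN.e_ne_none this
      rw [h] at hV
      cases hV
  · exact KN.e_extend h

theorem KN.f_extend_two (T : KN p q) : KN.f .n2 T.extend = (KN.f .n2 T).map KN.extend := by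
  rcases h : KN.f .n2 T with _ | T'
  · rcases h' : KN.f .n2 T.extend with _ | U
    · rfl
    · have := (KN.f_sig h').1
      rw [T.sig_extend_two] at this
      obtain ⟨V, hV⟩ := KN.f_ne_none this
      rw [h] at hV
      cases hV
  · exact KN.f_extend h

theorem KN.str_extend (i j : Node) (T : KN p q) :
    (crystal (p + 2) q).str i j T.extend = strWord i j (.oneBar :: (word T.1 ++ [.one])) := by
  rw [str_eq_strWord, ← T.word_extend.strWord]

theorem KN.str_extend_one {T : KN p q} {a b c d : ℕ}
    (h : (crystal p q).str .n1 .n2 T = (a, b, c, d)) :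
    (crystal (p + 2) q).str .n1 .n2 T.extend = (a + 1, b + 1, c + 1, d) := by
  rw [KN.str_extend]
  rw [str_eq_strWord] at h
  exact strWord_frame_one h

theorem KN.str_extend_two {T : KN p q} {a b c d : ℕ}
    (h : (crystal p q).str .n2 .n1 T = (a, b, c, d)) :
    (crystal (p + 2) q).str .n2 .n1 T.extend = (a, b + 1, c + 1, d + 1) := by
  rw [KN.str_extend]
  rw [str_eq_strWord] at h
  exact strWord_frame_two h

theorem KN.extend_injective : Function.Injective (KN.extend : KN p q → KN (p + 2) q) := by
  intro T U h
  have hs : (crystal p q).str .n1 .n2 T = (crystal p q).str .n1 .n2 U := by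
    rcases hT : (crystal p q).str .n1 .n2 T with ⟨a, b, c, d⟩
    rcases hU : (crystal p q).str .n1 .n2 U with ⟨a', b', c', d'⟩
    have := KN.str_extend_one hT
    rw [h, KN.str_extend_one hU] at this
    simp only [Prod.mk.injEq] at this ⊢
    omega
  have hij : Node.n1 ≠ Node.n2 := by decide
  have h1 := lower_str_highest hij T
  rw [hs, lower_str_highest hij U] at h1
  exact (Option.some.inj h1).symm

theorem KN.isCrystalEmbedding_extend :
    IsCrystalEmbedding (crystal p q) (crystal (p + 2) q) KN.extend where
  injective := KN.extend_injective
  wt_eq T := by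
    change wtWord (word (KN.extend T).1) = wtWord (word T.1)
    rw [← (KN.word_extend T).wtWord_eq]
    -- The weights of the framing letters `1̄` and `1` cancel.
    simp [wtWord]
  map_e _ _ _ h := KN.e_extend h
  map_f _ _ _ h := KN.f_extend h

theorem KN.extend_eq_embTab (T : KN p q) : T.extend.1 = embTab T.1 :=
  (map_fixColumn_ofRows T.isChain).symm

theorem KN.extend_eq_insertTab (T : KN p q) :
    T.extend.1 = appendRow1 (insertTab .one T.1) .oneBar := by
  rw [insertTab_eq_shiftTab T.isChain]; rfl

end

end C2


theorem mainTheorem5 (p q : ℕ) :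
    ∃ Φ : C2.KN p q → C2.KN (p + 2) q,
      -- an embedding of crystals, which for the index `2` also detects vanishing
      C2.IsCrystalEmbedding (C2.crystal p q) (C2.crystal (p + 2) q) Φ ∧
      (∀ T, C2.KN.e .n2 (Φ T) = (C2.KN.e .n2 T).map Φ) ∧
      (∀ T, C2.KN.f .n2 (Φ T) = (C2.KN.f .n2 T).map Φ) ∧
      -- the description on tableaux, and by column insertion
      (∀ T, (Φ T).1 = C2.embTab T.1) ∧
      (∀ T, (Φ T).1 = C2.appendRow1 (C2.insertTab .one T.1) .oneBar) ∧
      -- the strings parametrize the elements, by lowering the highest weight vertex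
      (∀ (i j : C2.Node) (T : C2.KN p q), i ≠ j →
        (C2.crystal p q).lower i j ((C2.crystal p q).str i j T) (C2.KN.highest p q) = some T) ∧
      -- the action on strings
      (∀ (T : C2.KN p q) (a b c d : ℕ), (C2.crystal p q).str .n1 .n2 T = (a, b, c, d) →
        (C2.crystal (p + 2) q).str .n1 .n2 (Φ T) = (a + 1, b + 1, c + 1, d)) ∧
      (∀ (T : C2.KN p q) (a b c d : ℕ), (C2.crystal p q).str .n2 .n1 T = (a, b, c, d) →
        (C2.crystal (p + 2) q).str .n2 .n1 (Φ T) = (a, b + 1, c + 1, d + 1)) := by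
  exact ⟨C2.KN.extend, C2.KN.isCrystalEmbedding_extend, C2.KN.e_extend_two, C2.KN.f_extend_two,
    C2.KN.extend_eq_embTab, C2.KN.extend_eq_insertTab, fun _ _ T hij => C2.lower_str_highest hij T,
    fun _ _ _ _ _ => C2.KN.str_extend_one, fun _ _ _ _ _ => C2.KN.str_extend_two⟩
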